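/- We use the following model. Let $m,q\in\mathbb{N}$. A \emph{probabilistic parallel decision tree of parallelism $q$} on the ground set $[m]$ is a rooted, possibly infinite tree with three kinds of nodes: (i) randomization nodes, with finitely many children ($b\ge 1$ of them), one of which is chosen uniformly at random; (ii) oracle query nodes, each carrying $q$ sets $B_1,\dots,B_q\subseteq[m]$ and having one child for each of the $2^q$ possible tuples of answers; (iii) leaves, each labelled by a set $B\subseteq[m]$. On input a matroid $M$ on $[m]$, the computation starts at the root; at a query node it moves to the child given by the answers of the independence oracle of $M$, i.e. by whether each $B_i$ is independent in $M$; and it stops with output $B$ at a leaf labelled $B$. Each query node on the path is one adaptive round. A matroid $M$ on $[m]$ is \emph{graphic} if $[m]$ is the edge set of a finite graph (loops and parallel edges allowed) such that a set of edges is independent in $M$ if and only if it contains no cycle. The tree \emph{solves} the basis problem on $m$ elements if, for every graphic matroid $M$ on $[m]$, the computation on $M$ reaches a leaf with probability $1$ and every leaf that it can reach is labelled by a basis of $M$ (equivalently, a spanning forest of the graph). Let $T(m,q)$ be the infimum, over all trees $H$ of parallelism $q$ that solve the basis problem on $m$ elements, of the maximum, over all graphic matroids $M$ on $[m]$, of the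 expected number of adaptive rounds of $H$ on $M$ (with $T(m,q)=\infty$ if there is no such $H$). \textbf{Theorem.} For every constant $c>0$ there are $K>0$ and $m_0\in\mathbb{N}$, depending only on $c$, such that for all $m\ge m_0$ and all $q\in\mathbb{N}$ with $q\le m^c$, $$T(m,q)\ \ge\ K\log m .$$ That is, any randomized algorithm that finds a basis of every graphic matroid on $m$ elements with at most $m^c$ independence queries per round needs $\Omega(\log m)$ adaptive rounds in expectation, in the worst case over graphic matroids on $m$ elements. -/

import Mathlib

open scoped ENNReal

namespace GraphicBasis

/-- `C` is the edge set of a cycle of the multigraph `G`: there are distinct vertices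
`v 0, …, v k` and distinct edges `e 0, …, e k` such that `e i` joins `v i` to `v (i + 1)`, with
indices taken modulo `k + 1`. A loop (`k = 0`) and a pair of parallel edges (`k = 1`) are cycles. -/
def IsCycleSet {V α : Type} (G : Graph V α) (C : Set α) : Prop :=
  ∃ (k : ℕ) (v : Fin (k + 1) → V) (e : Fin (k + 1) → α),
    Function.Injective v ∧ Function.Injective e ∧
      (∀ i, G.IsLink (e i) (v i) (v (i + 1))) ∧ C = Set.range e

/-- The matroid `M` is graphic: its ground set is the edge set of a finite (multi)graph, and a set
of edges is independent exactly when it contains no cycle. -/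
def IsGraphic {α : Type} (M : Matroid α) : Prop :=
  ∃ (V : Type) (_ : Finite V) (G : Graph V α), G.edgeSet = M.E ∧
    ∀ S ⊆ M.E, M.Indep S ↔ ∀ C ⊆ S, ¬ IsCycleSet G C

/-- `M` is a graphic matroid on `m` elements, its ground set being labelled by `Fin m`. -/
def IsGraphicOn (m : ℕ) (M : Matroid (Fin m)) : Prop :=
  IsGraphic M ∧ M.E = Set.univ

/-- The independence oracle: is the set `B` independent in `M`? -/
noncomputable def oracle {m : ℕ} (M : Matroid (Fin m)) (B : Finset (Fin m)) : Bool :=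
  open Classical in decide (M.Indep (B : Set (Fin m)))

/-- The kinds of nodes of a probabilistic parallel decision tree, with children in `N`:
a leaf, carrying the output; a randomization node with `b + 1` equally likely branches; and an
oracle query node, which asks `q` queries at once and has one branch for every tuple of answers. -/
inductive Node (m q : ℕ) (N : Type) : Type
  | leaf (B : Finset (Fin m)) : Node m q N
  | random (b : ℕ) (next : Fin (b + 1) → N) : Node m q N
  | query (B : Fin q → Finset (Fin m)) (next : (Fin q → Bool) → N) : Node m q N

/-- A probabilistic parallel decision tree of parallelism `q` on the ground set `Fin m`. It may have
infinite paths, so that procedures without a worst-case bound on the number of rounds are covered.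
It is given by a type of nodes, the root, and the kind of each node together with its children;
the tree meant is the unfolding from the root. -/
structure DecisionTree (m q : ℕ) where
  N : Type
  root : N
  node : N → Node m q N

namespace DecisionTree

variable {m q : ℕ}

/-- On input `M`, a path that starts at the node `x` can reach a leaf labelled `B`. -/
inductive Reaches (H : DecisionTree m q) (M : Matroid (Fin m)) : H.N → Finset (Fin m) → Prop
  | leaf (x : H.N) (B : Finset (Fin m)) (hx : H.node x = Node.leaf B) : Reaches H M x B
  | random (x : H.N) (b : ℕ) (next : Fin (b + 1) → H.N) (hx : H.node x = Node.random b next)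
      (i : Fin (b + 1)) (B : Finset (Fin m)) (h : Reaches H M (next i) B) : Reaches H M x B
  | query (x : H.N) (Q : Fin q → Finset (Fin m)) (next : (Fin q → Bool) → H.N)
      (hx : H.node x = Node.query Q next) (B : Finset (Fin m))
      (h : Reaches H M (next fun i => oracle M (Q i)) B) : Reaches H M x B

/-- The probability that, on input `M`, the computation started at a node reaches a leaf along
a path with at most `n` nodes. -/
noncomputable def haltProb (H : DecisionTree m q) (M : Matroid (Fin m)) : ℕ → H.N → ℝ≥0∞
  | 0, _ => 0
  | n + 1, x =>
    match H.node x with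
    | .leaf _ => 1
    | .random b next => (∑ i, haltProb H M n (next i)) / ((b + 1 : ℕ) : ℝ≥0∞)
    | .query Q next => haltProb H M n (next fun i => oracle M (Q i))

/-- The expected number of oracle query nodes among the first `n` nodes of the computation started
at a node, on input `M`. -/
noncomputable def roundsUpTo (H : DecisionTree m q) (M : Matroid (Fin m)) : ℕ → H.N → ℝ≥0∞
  | 0, _ => 0
  | n + 1, x =>
    match H.node x with
    | .leaf _ => 0
    | .random b next => (∑ i, roundsUpTo H M n (next i)) / ((b + 1 : ℕ) : ℝ≥0∞)
    | .query Q next => 1 + roundsUpTo H M n (next fun i => oracle M (Q i))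

/-- The expected number of adaptive rounds (oracle query nodes) of the computation of `H` on `M`. -/
noncomputable def expectedRounds (H : DecisionTree m q) (M : Matroid (Fin m)) : ℝ≥0∞ :=
  ⨆ n, roundsUpTo H M n H.root

/-- `H` finds a basis of every graphic matroid on `m` elements: the computation reaches a leaf
almost surely (automatic if `H` is finite), and every leaf it can reach is labelled by a basis. -/
def Solves (H : DecisionTree m q) : Prop :=
  ∀ M : Matroid (Fin m), IsGraphicOn m M →
    (⨆ n, haltProb H M n H.root) = 1 ∧ ∀ B, Reaches H M H.root B → M.IsBase (B : Set (Fin m))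

/-- The worst-case expected number of rounds of `H` over all graphic matroids on `m` elements. -/
noncomputable def worstCaseRounds (H : DecisionTree m q) : ℝ≥0∞ :=
  ⨆ (M : Matroid (Fin m)) (_ : IsGraphicOn m M), H.expectedRounds M

end DecisionTree

/-- The least worst-case expected number of rounds of a probabilistic parallel decision tree of
parallelism `q` that finds a basis of every graphic matroid on `m` elements (`∞` if no tree does). -/
noncomputable def probRounds (m q : ℕ) : ℝ≥0∞ :=
  ⨅ (H : DecisionTree m q) (_ : H.Solves), H.worstCaseRounds

end GraphicBasis

/-! The hard instances are disjoint unions of cycles, so the matroid is a partition of `Fin m` into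
colour classes and a set is independent iff it contains no class. There are `k` levels with `n = N ^
2` colours each. Every element gets an independent random colour, a colour of level `i` having
weight `R ^ i`, so that classes grow by a factor of about `R` per level.

The point is that one round of queries reveals essentially one level. Suppose the elements of level
below `t` are known, let `p` be the chance that a hidden element has a given colour of level `t`,
and let `w` be the number of hidden elements outside a query `B`. If `(1 - p) ^ w ≥ 1 / N`, each
class of level `t` lies in `B` with chance at least `1 / N`. By negative correlation of the colours
(`card_filter_forall_exists_le`), some such class lies in `B` except with probability `exp (-N)`, so
the answer is "dependent". If `(1 - p) ^ w ≤ 1 / N`, a colour of higher level has chance at least `R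
* p`, so its class lies in `B` with probability at most `N ^ (-R)`. Either way the levels above `t`
almost never influence the answer (`card_mismatch_le`). Revealing level `t` as well keeps the
conditional law a product of uniform laws, and the argument repeats (`sum_successProb_le`).

While some level is hidden, no output is likely to be a basis (`card_filter_isBase_le`): a basis
misses at most one element of each colour, hence few hidden elements, and such a set most likely
contains a class of the lowest hidden level. Thus success within `k - 1` rounds is unlikely for a
random instance, and Markov's inequality with averaging over instances gives `k / 2` expected rounds
on some instance. With `R` a constant depending on `c`, `N` about `m ^ (1/8)` and `k` about `log N /
log R`, this is of order `log m`. -/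

namespace GraphicBasis

/-! ### Disjoint unions of cycles as graphic matroids. -/

section FiberMatroid

variable {α κ : Type}

/-- The matroid on `α` whose circuits are the nonempty fibres of the colouring `χ`. -/
noncomputable def fiberMatroid [Finite α] (χ : α → κ) : Matroid α :=
  (IndepMatroid.ofFinite (E := Set.univ) Set.finite_univ
    (fun I => ∀ a, ∃ b, χ b = χ a ∧ b ∉ I)
    (fun a => ⟨a, rfl, fun h => h⟩)
    (fun I J hJ hIJ a => by
      obtain ⟨b, hb, hbJ⟩ := hJ a
      exact ⟨b, hb, fun h => hbJ (hIJ h)⟩)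
    (by
      intro I J hI hJ hlt
      by_contra! hcon
      -- If `e` cannot be added to `I`, then `e` is the only element of its fibre outside `I`, while
      -- `J` misses some `b` of that fibre. Sending `e` to `b` is injective, because the fibre
      -- determines `e`; hence `J` is no larger than `I`.
      have key : ∀ e ∈ J \ I, ∃ b ∈ I \ J, χ b = χ e ∧ ∀ b', χ b' = χ e → b' ∉ I → b' = e := by
        intro e he
        obtain ⟨a, ha⟩ := hcon e he.1 he.2
        obtain ⟨b₀, hb₀, hb₀I⟩ := hI a
        have h₀ : b₀ = e := by
          have := ha b₀ hb₀
          rcases this with h | h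
          · exact h
          · exact absurd h hb₀I
        subst h₀
        obtain ⟨b, hb, hbJ⟩ := hJ b₀
        have huniq : ∀ b', χ b' = χ b₀ → b' ∉ I → b' = b₀ := by
          intro b' hb' hb'I
          rcases ha b' (hb'.trans hb₀) with h | h
          · exact h
          · exact absurd h hb'I
        refine ⟨b, ⟨?_, hbJ⟩, hb, huniq⟩
        by_contra hbI
        exact hbJ (huniq b hb hbI ▸ he.1)
      choose! φ hφ using key
      have hle : (J \ I).ncard ≤ (I \ J).ncard := by
        refine Set.ncard_le_ncard_of_injOn φ (fun e he => (hφ e he).1) ?_ (Set.toFinite _)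
        intro e he e' he' h
        refine (hφ e' he').2.2 e ?_ he.2
        rw [← (hφ e he).2.1, h, (hφ e' he').2.1]
      have h1 := Set.ncard_sdiff_add_ncard J I (Set.toFinite _) (Set.toFinite _)
      have h2 := Set.ncard_sdiff_add_ncard I J (Set.toFinite _) (Set.toFinite _)
      rw [Set.union_comm] at h2
      omega)
    (fun _ _ => Set.subset_univ _)).matroid

theorem fiberMatroid_indep [Finite α] (χ : α → κ) (I : Set α) :
    (fiberMatroid χ).Indep I ↔ ∀ a, ∃ b, χ b = χ a ∧ b ∉ I := by
  simp [fiberMatroid]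

/-- Outside a base of `fiberMatroid χ`, distinct elements have distinct colours. -/
theorem injOn_compl_of_isBase_fiberMatroid [Finite α] {χ : α → κ} {B : Set α} (hB : (fiberMatroid χ).IsBase B) :
    Set.InjOn χ Bᶜ := by
  intro e he e' he' h
  by_contra hne
  refine (hB.insert_dep ⟨Set.mem_univ e, he⟩).not_indep ((fiberMatroid_indep χ _).2 fun a => ?_)
  by_cases ha : χ a = χ e
  · refine ⟨e', h.symm.trans ha.symm, ?_⟩
    rintro (h' | h')
    · exact hne h'.symm
    · exact he' h'
  · obtain ⟨b, hb, hbB⟩ := (fiberMatroid_indep χ _).1 hB.indep a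
    refine ⟨b, hb, ?_⟩
    rintro (h' | h')
    · exact ha (hb.symm.trans (h' ▸ rfl))
    · exact hbB h'

/-- The graph on the vertex set `α` in which the edge `e` joins `e` to `τ e`. -/
def successorGraph (τ : α → α) : Graph α α where
  vertexSet := Set.univ
  IsLink e x y := (x = e ∧ y = τ e) ∨ (x = τ e ∧ y = e)
  edgeSet := Set.univ
  isLink_symm _ _ := ⟨fun _ _ h => by tauto⟩
  eq_or_eq_of_isLink_of_isLink := by
    rintro e x y v w (⟨rfl, rfl⟩ | ⟨rfl, rfl⟩) (⟨rfl, rfl⟩ | ⟨rfl, rfl⟩) <;> simp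
  edge_mem_iff_exists_isLink e := ⟨fun _ => ⟨e, τ e, Or.inl ⟨rfl, rfl⟩⟩, fun _ => Set.mem_univ _⟩
  left_mem_of_isLink _ _ _ _ := Set.mem_univ _

theorem successorGraph_isLink {τ : α → α} {e x y : α} :
    (successorGraph τ).IsLink e x y ↔ (x = e ∧ y = τ e) ∨ (x = τ e ∧ y = e) := Iff.rfl

/-- A cycle of `successorGraph τ` is closed under `τ`. -/
theorem apply_mem_of_isCycleSet {τ : α → α} (hτ : Function.Injective τ) {C : Set α}
    (hC : IsCycleSet (successorGraph τ) C) {x : α} (hx : x ∈ C) : τ x ∈ C := by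
  obtain ⟨k, v, e, hv, he, hl, rfl⟩ := hC
  obtain ⟨i, rfl⟩ := hx
  have key : ∀ i j : Fin (k + 1), v j = τ (e i) → τ (e i) ∈ Set.range e := by
    intro i j hj
    -- Only the edges `y` and `τ⁻¹ y` meet a vertex `y`. If the cycle avoids the edge `v j`, then `e
    -- j` and `e (j - 1)` coincide, so the cycle has length one; its edge is then a loop at `v j`,
    -- which is the edge `v j` itself.
    by_contra hne
    have h1 : τ (e j) = v j ∧ e j ≠ v j ∨ e j = v j := by
      rcases hl j with h | h
      · exact Or.inr h.1.symm
      · by_cases h' : e j = v j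
        · exact Or.inr h'
        · exact Or.inl ⟨h.1.symm, h'⟩
    have hjj : j - 1 + 1 = j := sub_add_cancel j 1
    have h2 : τ (e (j - 1)) = v j ∨ e (j - 1) = v j := by
      have hl' := hl (j - 1)
      rw [hjj] at hl'
      rcases hl' with h | h
      · exact Or.inl h.2.symm
      · exact Or.inr h.2.symm
    rcases h1 with h1 | h1
    · rcases h2 with h2 | h2
      · have : e j = e (j - 1) := hτ (h1.1.trans h2.symm)
        have hj1 : j = j - 1 := he this
        have := hl j
        rw [successorGraph_isLink] at this
        have hvv : v (j + 1) = v j := by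
          congr 1
          exact (congrArg (· + 1) hj1).trans hjj
        rw [hvv] at this
        rcases this with h | h
        · exact h1.2 h.1.symm
        · exact h1.2 h.2.symm
      · exact hne ⟨j - 1, h2.trans hj⟩
    · exact hne ⟨j, h1.trans hj⟩
  rcases hl i with h | h
  · exact key i (i + 1) h.2
  · exact key i i h.1

/-- Let `τ` permute each fibre cyclically. The successor graph of `τ` is then a disjoint union of
cycles, one on each nonempty fibre; a cycle set is closed under `τ`, so it contains the whole fibre
of each of its elements. -/
theorem isGraphic_fiberMatroid [Finite α] (χ : α → κ) : IsGraphic (fiberMatroid χ) := by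
  classical
  have := Fintype.ofFinite α
  let F : κ → Finset α := fun c => Finset.univ.filter fun a => χ a = c
  have hF : ∀ {a c}, a ∈ F c ↔ χ a = c := by simp [F]
  choose σ hσ _ using fun c => (F c).exists_cycleOn
  let τ : α → α := fun a => σ (χ a) a
  have hτχ : ∀ a, χ (τ a) = χ a := fun a =>
    hF.1 ((hσ (χ a)).apply_mem_iff.2 (hF.2 rfl : a ∈ F (χ a)))
  have hτ : Function.Injective τ := by
    intro a b h
    have hab : χ a = χ b := by rw [← hτχ a, h, hτχ]
    simp only [τ, hab] at h
    exact (σ (χ b)).injective h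
  have hpow : ∀ a (i : ℕ), χ ((σ (χ a) ^ i) a) = χ a := by
    intro a i
    induction i with
    | zero => simp
    | succ i ih =>
      rw [pow_succ', Equiv.Perm.mul_apply]
      exact hF.1 ((hσ (χ a)).apply_mem_iff.2 (hF.2 ih))
  refine ⟨α, inferInstance, successorGraph τ, rfl, fun S _ => ?_⟩
  rw [fiberMatroid_indep]
  constructor
  · intro hS C hCS hC
    have hCn : C.Nonempty := by
      obtain ⟨k, v, e, -, -, -, rfl⟩ := hC
      exact ⟨e 0, 0, rfl⟩
    obtain ⟨a, ha⟩ := hCn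
    obtain ⟨b, hb, hbS⟩ := hS a
    have hmem : ∀ i : ℕ, (σ (χ a) ^ i) a ∈ C := by
      intro i
      induction i with
      | zero => simpa using ha
      | succ i ih =>
        have := apply_mem_of_isCycleSet hτ hC ih
        simp only [τ, hpow] at this
        rwa [pow_succ', Equiv.Perm.mul_apply]
    obtain ⟨i, -, hi⟩ := (hσ (χ a)).exists_pow_eq (hF.2 rfl) (hF.2 hb)
    exact hbS (hCS (hi ▸ hmem i))
  · intro hS a
    by_contra! hcon
    have haF : a ∈ F (χ a) := hF.2 rfl
    obtain ⟨k, hk⟩ : ∃ k, (F (χ a)).card = k + 1 :=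
      Nat.exists_eq_succ_of_ne_zero (Finset.card_pos.2 ⟨a, haF⟩).ne'
    have hinj : Function.Injective fun i : Fin (k + 1) => (σ (χ a) ^ (i : ℕ)) a := by
      intro i j h
      have := ((hσ (χ a)).pow_apply_eq_pow_apply haF).1 h
      rw [hk] at this
      exact Fin.ext (Nat.ModEq.eq_of_lt_of_lt this i.2 j.2)
    refine hS (F (χ a)) (fun b hb => hcon b (hF.1 hb)) ⟨k, _, _, hinj, hinj, fun i => ?_, ?_⟩
    · refine Or.inl ⟨rfl, ?_⟩
      simp only [τ, hpow]
      rw [← Equiv.Perm.mul_apply, ← pow_succ']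
      rw [(hσ (χ a)).pow_apply_eq_pow_apply haF, hk, Fin.val_add]
      simp [Nat.ModEq]
    · ext b
      constructor
      · intro hb
        obtain ⟨i, hi, h⟩ := (hσ (χ a)).exists_pow_eq haF hb
        exact ⟨⟨i, hk ▸ hi⟩, h⟩
      · rintro ⟨i, rfl⟩
        exact hF.2 (hpow a i)

theorem isGraphicOn_fiberMatroid {m : ℕ} (χ : Fin m → κ) : IsGraphicOn m (fiberMatroid χ) :=
  ⟨isGraphic_fiberMatroid χ, rfl⟩

end FiberMatroid

/-! ### Counting in product spaces: independent random colours. -/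

section RandomColoring

variable {ι Λ κ : Type} [Fintype ι] [DecidableEq ι] [DecidableEq κ]

theorem pow_add_mul_pow_mul_le_add_pow {x y : ℝ} (hx : 0 ≤ x) (hy : 0 ≤ y) (j : ℕ) :
    x ^ (j + 1) + (j + 1) * x ^ j * y ≤ (x + y) ^ (j + 1) := by
  induction j with
  | zero => simp
  | succ j ih =>
    calc x ^ (j + 1 + 1) + ((j + 1 : ℕ) + 1) * x ^ (j + 1) * y
        ≤ x ^ (j + 1 + 1) + ((j + 1 : ℕ) + 1) * x ^ (j + 1) * y + (j + 1) * x ^ j * y ^ 2 :=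
          le_add_of_nonneg_right (by positivity)
      _ = (x + y) * (x ^ (j + 1) + (j + 1) * x ^ j * y) := by push_cast; ring
      _ ≤ (x + y) * (x + y) ^ (j + 1) := by gcongr
      _ = (x + y) ^ (j + 1 + 1) := by ring

/-- Conditioning one coordinate of a product space; stated without division. -/
theorem card_piFinset_update (A : ι → Finset Λ) (a : ι) (T : Finset Λ) :
    ((Fintype.piFinset (Function.update A a T)).card : ℝ) * (A a).card =
      T.card * (Fintype.piFinset A).card := by
  rw [Fintype.card_piFinset, Fintype.card_piFinset]
  rw [← Finset.mul_prod_erase _ _ (Finset.mem_univ a),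
    ← Finset.mul_prod_erase (f := fun i => (A i).card) _ (Finset.mem_univ a)]
  have : ∏ i ∈ Finset.univ.erase a, (Function.update A a T i).card =
      ∏ i ∈ Finset.univ.erase a, (A i).card :=
    Finset.prod_congr rfl fun i hi => by rw [Function.update_of_ne (Finset.ne_of_mem_erase hi)]
  rw [this, Function.update_self]
  push_cast
  ring

theorem card_piFinset_update_eq {A : ι → Finset Λ} {a : ι} {S : Finset Λ} (hA : A a = S)
    (hS : 0 < S.card) (T : Finset Λ) :
    ((Fintype.piFinset (Function.update A a T)).card : ℝ) =
      T.card / S.card * (Fintype.piFinset A).card := by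
  have h := card_piFinset_update A a T
  rw [hA] at h
  have : (0 : ℝ) < S.card := by exact_mod_cast hS
  field_simp
  linarith

theorem mem_piFinset_update {A : ι → Finset Λ} {f : ι → Λ} (hf : f ∈ Fintype.piFinset A) {a : ι}
    {T : Finset Λ} (hT : f a ∈ T) : f ∈ Fintype.piFinset (Function.update A a T) := by
  rw [Fintype.mem_piFinset] at hf ⊢
  intro i
  by_cases h : i = a
  · subst h; simpa using hT
  · rw [Function.update_of_ne h]; exact hf i

/-- The colours of a uniformly random colouring are hit in a negatively correlated way: the chance
that all colours in `J` are hit on `W` is at most the product of the individual chances. -/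
theorem card_filter_forall_exists_le [DecidableEq Λ] (χ : Λ → κ) (S : Finset Λ) (hS : 0 < S.card) {p : ℝ}
    (hp : 0 ≤ p) (hp1 : p ≤ 1) (W : Finset ι) :
    ∀ (A : ι → Finset Λ) (_ : ∀ e ∈ W, A e = S) (J : Finset κ)
      (_ : ∀ j ∈ J, ((S.filter fun l => χ l = j).card : ℝ) = p * S.card),
      (((Fintype.piFinset A).filter fun f => ∀ j ∈ J, ∃ e ∈ W, χ (f e) = j).card : ℝ) ≤
        (1 - (1 - p) ^ W.card) ^ J.card * (Fintype.piFinset A).card := by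
  induction W using Finset.induction_on with
  | empty =>
    intro A _ J _
    rcases J.eq_empty_or_nonempty with rfl | hJ
    · simp
    · obtain ⟨j, hj⟩ := hJ
      rw [Finset.filter_false_of_mem]
      · simp [(Finset.card_pos.2 ⟨j, hj⟩).ne']
      · intro f _ h
        obtain ⟨e, he, _⟩ := h j hj
        simp at he
  | insert a W ha ih =>
    intro A hA J hJ
    have hAa : A a = S := hA a (Finset.mem_insert_self _ _)
    set P : ℝ := ((Fintype.piFinset A).card : ℝ) with hP
    set x : ℝ := 1 - (1 - p) ^ W.card with hx
    have hx0 : 0 ≤ x := sub_nonneg.2 (pow_le_one₀ (by linarith) (by linarith))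
    have hx1 : 0 ≤ 1 - x := by rw [hx, sub_sub_cancel]; exact pow_nonneg (by linarith) _
    have hS' : (0 : ℝ) < S.card := by exact_mod_cast hS
    have hA' : ∀ T : Finset Λ, ∀ e ∈ W, Function.update A a T e = S := by
      intro T e he
      rw [Function.update_of_ne (ne_of_mem_of_not_mem he ha)]
      exact hA e (Finset.mem_insert_of_mem he)
    -- Split by the colour of the new element `a`. In `X i` it is `i ∈ J`, so `W` need only hit the
    -- other colours of `J`; in `Y` it is outside `J`, so `W` must hit all of them.
    let X : κ → Finset (ι → Λ) := fun i =>
      (Fintype.piFinset (Function.update A a (S.filter fun l => χ l = i))).filter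
        fun f => ∀ j ∈ J.erase i, ∃ e ∈ W, χ (f e) = j
    let Y : Finset (ι → Λ) :=
      (Fintype.piFinset (Function.update A a (S.filter fun l => χ l ∉ J))).filter
        fun f => ∀ j ∈ J, ∃ e ∈ W, χ (f e) = j
    have hsub : ((Fintype.piFinset A).filter fun f => ∀ j ∈ J, ∃ e ∈ insert a W, χ (f e) = j) ⊆
        J.biUnion X ∪ Y := by
      intro f hf
      rw [Finset.mem_filter] at hf
      obtain ⟨hfA, hf⟩ := hf
      have hfa : f a ∈ S := hAa ▸ Fintype.mem_piFinset.1 hfA a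
      by_cases hc : χ (f a) ∈ J
      · refine Finset.mem_union_left _ (Finset.mem_biUnion.2 ⟨χ (f a), hc, Finset.mem_filter.2
          ⟨mem_piFinset_update hfA (Finset.mem_filter.2 ⟨hfa, rfl⟩), fun j hj => ?_⟩⟩)
        obtain ⟨e, he, hej⟩ := hf j (Finset.mem_of_mem_erase hj)
        rcases Finset.mem_insert.1 he with rfl | he
        · exact absurd hej.symm (Finset.ne_of_mem_erase hj)
        · exact ⟨e, he, hej⟩
      · refine Finset.mem_union_right _ (Finset.mem_filter.2
          ⟨mem_piFinset_update hfA (Finset.mem_filter.2 ⟨hfa, hc⟩), fun j hj => ?_⟩)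
        obtain ⟨e, he, hej⟩ := hf j hj
        rcases Finset.mem_insert.1 he with rfl | he
        · exact absurd (hej ▸ hj) hc
        · exact ⟨e, he, hej⟩
    have hX : ∀ i ∈ J, ((X i).card : ℝ) ≤ x ^ (J.card - 1) * (p * P) := by
      intro i hi
      refine (ih _ (hA' _) (J.erase i) fun j hj => hJ j (Finset.mem_of_mem_erase hj)).trans ?_
      rw [Finset.card_erase_of_mem hi, card_piFinset_update_eq hAa hS, hJ i hi,
        mul_div_cancel_right₀ _ hS'.ne']
    have hYc : ((S.filter fun l => χ l ∉ J).card : ℝ) = (1 - J.card * p) * S.card := by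
      have h1 : ((S.filter fun l => χ l ∈ J).card : ℝ) = J.card * p * S.card := by
        have := Finset.card_eq_sum_card_fiberwise (f := χ) (s := S.filter fun l => χ l ∈ J) (t := J)
          (fun l hl => (Finset.mem_filter.1 hl).2)
        rw [this]
        push_cast
        rw [Finset.sum_congr rfl (g := fun _ => p * (S.card : ℝ)), Finset.sum_const, nsmul_eq_mul,
          mul_assoc]
        intro j hj
        rw [← hJ j hj, Finset.filter_filter]
        congr 2
        ext l
        simp only [Finset.mem_filter]
        constructor
        · exact fun h => ⟨h.1, h.2.2⟩
        · exact fun h => ⟨h.1, h.2 ▸ hj, h.2⟩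
      have h2 := Finset.card_filter_add_card_filter_not (s := S) (fun l => χ l ∈ J)
      have h3 : ((S.filter fun l => χ l ∈ J).card : ℝ) + (S.filter fun l => χ l ∉ J).card =
        S.card := by exact_mod_cast h2
      rw [h1] at h3
      linarith
    have hY : (Y.card : ℝ) ≤ x ^ J.card * ((1 - J.card * p) * P) := by
      refine (ih _ (hA' _) J hJ).trans ?_
      rw [card_piFinset_update_eq hAa hS, hYc, mul_div_cancel_right₀ _ hS'.ne']
    have hw : 1 - (1 - p) ^ (insert a W).card = x + p * (1 - x) := by
      rw [Finset.card_insert_of_notMem ha, hx]; ring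
    rw [hw]
    calc _ ≤ (((J.biUnion X) ∪ Y).card : ℝ) := by exact_mod_cast Finset.card_le_card hsub
      _ ≤ (J.biUnion X).card + Y.card := by exact_mod_cast Finset.card_union_le _ _
      _ ≤ (∑ i ∈ J, ((X i).card : ℝ)) + Y.card := by
        gcongr; exact_mod_cast Finset.card_biUnion_le
      _ ≤ J.card * (x ^ (J.card - 1) * (p * P)) + x ^ J.card * ((1 - J.card * p) * P) := by
        refine add_le_add ((Finset.sum_le_sum hX).trans ?_) hY
        rw [Finset.sum_const, nsmul_eq_mul]
      _ ≤ (x + p * (1 - x)) ^ J.card * P := by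
        -- With `s = J.card`, the sum is `P` times `x ^ s + s * x ^ (s - 1) * p * (1 - x)`, the
        -- first two binomial terms of `(x + p * (1 - x)) ^ s`. The case `s = 0` is separate because
        -- `s - 1` is truncated.
        have hP0 : 0 ≤ P := Nat.cast_nonneg _
        rcases Nat.eq_zero_or_pos J.card with h0 | h0
        · simp [h0]
        · obtain ⟨j, hj⟩ := Nat.exists_eq_succ_of_ne_zero h0.ne'
          rw [hj]
          have := mul_le_mul_of_nonneg_right
            (pow_add_mul_pow_mul_le_add_pow hx0 (mul_nonneg hp hx1) j) hP0
          refine le_trans (le_of_eq ?_) this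
          simp only [Nat.succ_eq_add_one, Nat.add_sub_cancel]
          push_cast
          ring

/-- The chance that a random colouring avoids the colour `c` on `W`. -/
theorem card_filter_forall_ne_le (χ : Λ → κ) (S : Finset Λ) (hS : 0 < S.card) {p : ℝ}
    (c : κ) (hc : ((S.filter fun l => χ l = c).card : ℝ) = p * S.card)
    (W : Finset ι) :
    ∀ (A : ι → Finset Λ) (_ : ∀ e ∈ W, A e = S),
      (((Fintype.piFinset A).filter fun f => ∀ e ∈ W, χ (f e) ≠ c).card : ℝ) ≤
        (1 - p) ^ W.card * (Fintype.piFinset A).card := by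
  induction W using Finset.induction_on with
  | empty => simp
  | insert a W ha ih =>
    intro A hA
    have hAa : A a = S := hA a (Finset.mem_insert_self _ _)
    have hS' : (0 : ℝ) < S.card := by exact_mod_cast hS
    have hcn : ((S.filter fun l => χ l ≠ c).card : ℝ) = (1 - p) * S.card := by
      have h2 := Finset.card_filter_add_card_filter_not (s := S) (fun l => χ l = c)
      have h3 : ((S.filter fun l => χ l = c).card : ℝ) + (S.filter fun l => χ l ≠ c).card =
        S.card := by exact_mod_cast h2
      rw [hc] at h3
      linarith
    have hsub : ((Fintype.piFinset A).filter fun f => ∀ e ∈ insert a W, χ (f e) ≠ c) ⊆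
        (Fintype.piFinset (Function.update A a (S.filter fun l => χ l ≠ c))).filter
          fun f => ∀ e ∈ W, χ (f e) ≠ c := by
      intro f hf
      rw [Finset.mem_filter] at hf ⊢
      have hfa : f a ∈ S := hAa ▸ Fintype.mem_piFinset.1 hf.1 a
      exact ⟨mem_piFinset_update hf.1
        (Finset.mem_filter.2 ⟨hfa, hf.2 a (Finset.mem_insert_self _ _)⟩),
        fun e he => hf.2 e (Finset.mem_insert_of_mem he)⟩
    refine (Nat.cast_le.2 (Finset.card_le_card hsub)).trans ((ih _ fun e he => ?_).trans ?_)
    · rw [Function.update_of_ne (ne_of_mem_of_not_mem he ha)]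
      exact hA e (Finset.mem_insert_of_mem he)
    · rw [card_piFinset_update_eq hAa hS, hcn, mul_div_cancel_right₀ _ hS'.ne',
        Finset.card_insert_of_notMem ha]
      exact le_of_eq (by ring)

end RandomColoring

/-! ### Success probability within a bounded number of rounds. -/

namespace DecisionTree

variable {m q : ℕ}

/-- The probability that, on input `M`, the computation started at a node outputs a base along
a path with at most `n` nodes, of which at most `j` are query nodes. -/
noncomputable def successProb (H : DecisionTree m q) (M : Matroid (Fin m)) :
    ℕ → ℕ → H.N → ℝ≥0∞
  | 0, _, _ => 0
  | n + 1, j, x =>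
    match H.node x with
    | .leaf B => open Classical in if M.IsBase (B : Set (Fin m)) then 1 else 0
    | .random b next => (∑ i, successProb H M n j (next i)) / ((b + 1 : ℕ) : ℝ≥0∞)
    | .query Q next =>
      match j with
      | 0 => 0
      | j + 1 => successProb H M n j (next fun i => oracle M (Q i))

theorem sum_div_le_of_le {b : ℕ} {g : Fin (b + 1) → ℝ≥0∞} {D : ℝ≥0∞} (h : ∀ i, g i ≤ D) :
    (∑ i, g i) / ((b + 1 : ℕ) : ℝ≥0∞) ≤ D := by
  refine ENNReal.div_le_of_le_mul ?_
  refine (Finset.sum_le_sum fun i _ => h i).trans ?_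
  simp [mul_comm]

theorem successProb_le_one (H : DecisionTree m q) (M : Matroid (Fin m)) (n : ℕ) :
    ∀ (j : ℕ) (x : H.N), H.successProb M n j x ≤ 1 := by
  induction n with
  | zero => simp [successProb]
  | succ n ih =>
    intro j x
    rw [successProb]
    cases H.node x with
    | leaf B => dsimp only; split_ifs <;> simp
    | random b next => exact sum_div_le_of_le fun i => ih _ _
    | query Q next =>
      cases j with
      | zero => simp
      | succ j => exact ih _ _

theorem haltProb_le_one (H : DecisionTree m q) (M : Matroid (Fin m)) (n : ℕ) :
    ∀ x : H.N, H.haltProb M n x ≤ 1 := by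
  induction n with
  | zero => simp [haltProb]
  | succ n ih =>
    intro x
    rw [haltProb]
    cases H.node x with
    | leaf B => simp
    | random b next => exact sum_div_le_of_le fun i => ih _
    | query Q next => exact ih _

theorem haltProb_le_succ (H : DecisionTree m q) (M : Matroid (Fin m)) (n : ℕ) :
    ∀ x : H.N, H.haltProb M n x ≤ H.haltProb M (n + 1) x := by
  induction n with
  | zero => simp [haltProb]
  | succ n ih =>
    intro x
    rw [haltProb, haltProb]
    cases H.node x with
    | leaf B => simp
    | random b next => exact ENNReal.div_le_div_right (Finset.sum_le_sum fun i _ => ih _) _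
    | query Q next => exact ih _

/-- Markov's inequality for the number of rounds of a computation whose outputs are bases. -/
theorem mul_haltProb_le (H : DecisionTree m q) (M : Matroid (Fin m)) (n : ℕ) :
    ∀ (j : ℕ) (x : H.N), (∀ B, H.Reaches M x B → M.IsBase (B : Set (Fin m))) →
      (j + 1 : ℕ) * H.haltProb M n x ≤ (j + 1 : ℕ) * H.successProb M n j x + H.roundsUpTo M n x := by
  induction n with
  | zero => simp [haltProb]
  | succ n ih =>
    intro j x hx
    rw [haltProb, successProb, roundsUpTo]
    cases hnode : H.node x with
    | leaf B => simp [hx B (Reaches.leaf x B hnode)]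
    | random b next =>
      dsimp only
      rw [← mul_div_assoc, ← mul_div_assoc, ← ENNReal.add_div, Finset.mul_sum, Finset.mul_sum,
        ← Finset.sum_add_distrib]
      refine ENNReal.div_le_div_right (Finset.sum_le_sum fun i _ => ih j _ fun B hB => ?_) _
      exact hx B (Reaches.random x b next hnode i B hB)
    | query Q next =>
      have hx' : ∀ B, H.Reaches M (next fun i => oracle M (Q i)) B → M.IsBase (B : Set (Fin m)) :=
        fun B hB => hx B (Reaches.query x Q next hnode B hB)
      have h1 := H.haltProb_le_one M n (next fun i => oracle M (Q i))
      -- With no query left, the success term vanishes and the round just made pays for the halting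
      -- probability, which is at most `1`. Otherwise the induction hypothesis has one query fewer,
      -- and the same round pays for the missing multiple of the halting probability.
      cases j with
      | zero =>
        simp only [zero_add, Nat.cast_one, one_mul]
        exact h1.trans le_self_add
      | succ j =>
        dsimp only
        have := ih j _ hx'
        push_cast at this ⊢
        calc _ = ((j : ℝ≥0∞) + 1) * H.haltProb M n (next fun i => oracle M (Q i)) +
              H.haltProb M n (next fun i => oracle M (Q i)) := by ring
          _ ≤ (((j : ℝ≥0∞) + 1) * H.successProb M n j (next fun i => oracle M (Q i)) +
              H.roundsUpTo M n (next fun i => oracle M (Q i))) + 1 := add_le_add this h1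
          _ ≤ _ := by
            rw [add_assoc, add_comm (H.roundsUpTo M n _) 1]
            gcongr
            exact le_self_add

end DecisionTree

/-! ### Random labellings, revealed level by level. -/

section Labelling

/-- The colours: `n` of them at each of `k` levels. -/
abbrev Color (k n : ℕ) : Type := Fin k × Fin n

/-- The labels of an element: a colour of level `i` comes with `R ^ i` labels. -/
abbrev Label (k n R : ℕ) : Type := (c : Color k n) × Fin (R ^ (c.1 : ℕ))

variable {m k n R : ℕ}

/-- The labels of level at least `t`. -/
def upperLabels (k n R t : ℕ) : Finset (Label k n R) := Finset.univ.filter fun l => t ≤ l.1.1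

/-- What is known about the labelling `f` when the elements of level below `t` are revealed. -/
def view (t : ℕ) (f : Fin m → Label k n R) (e : Fin m) : Finset (Label k n R) :=
  if ((f e).1.1 : ℕ) < t then {f e} else upperLabels k n R t

/-- The labellings that agree with `f` as far as the elements of level below `t` are concerned. -/
def viewClass (t : ℕ) (f : Fin m → Label k n R) : Finset (Fin m → Label k n R) :=
  Fintype.piFinset (view t f)

/-- The set `B` contains all elements of colour `c`. -/
def ContainsColor (f : Fin m → Label k n R) (B : Finset (Fin m)) (c : Color k n) : Prop :=
  ∀ e, (f e).1 = c → e ∈ B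

/-- The matroid whose circuits are the colour classes. -/
noncomputable def labelMatroid (f : Fin m → Label k n R) : Matroid (Fin m) :=
  fiberMatroid fun e => (f e).1

/-- Every colour occurs. -/
def IsFull (f : Fin m → Label k n R) : Prop := ∀ c : Color k n, ∃ e, (f e).1 = c

open Classical in
/-- The answer of the independence oracle if only the colours of level at most `t` are seen. -/
noncomputable def truncatedOracle (t : ℕ) (f : Fin m → Label k n R) (B : Finset (Fin m)) : Bool :=
  decide (∀ c : Color k n, (c.1 : ℕ) ≤ t → ¬ ContainsColor f B c)

open Classical in
/-- The labellings in a class for which seeing only the colours of level at most `t`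
changes the answer to the query `B`. -/
noncomputable def mismatch (t : ℕ) (f₀ : Fin m → Label k n R) (B : Finset (Fin m)) :
    Finset (Fin m → Label k n R) :=
  (viewClass t f₀).filter fun f => (∃ c : Color k n, t < (c.1 : ℕ) ∧ ContainsColor f B c) ∧
    ∀ c : Color k n, (c.1 : ℕ) ≤ t → ¬ ContainsColor f B c

theorem mem_viewClass_self (t : ℕ) (f : Fin m → Label k n R) : f ∈ viewClass t f := by
  refine Fintype.mem_piFinset.2 fun e => ?_
  by_cases h : ((f e).1.1 : ℕ) < t
  · simp [view, h]
  · simp only [view, h, if_false, upperLabels, Finset.mem_filter, Finset.mem_univ, true_and]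
    omega

theorem mem_viewClass {t : ℕ} {f f₀ : Fin m → Label k n R} :
    f ∈ viewClass t f₀ ↔ ∀ e, (((f₀ e).1.1 : ℕ) < t → f e = f₀ e) ∧
      (t ≤ ((f₀ e).1.1 : ℕ) → t ≤ ((f e).1.1 : ℕ)) := by
  refine Fintype.mem_piFinset.trans (forall_congr' fun e => ?_)
  by_cases h : ((f₀ e).1.1 : ℕ) < t
  · simp [view, h]
  · simp only [view, h, if_false, upperLabels, Finset.mem_filter, Finset.mem_univ, true_and]
    simp [not_lt.1 h]

/-- The classes for a fixed `t` are the fibres of `view t`, hence a partition of the labellings. -/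
theorem view_eq_iff {t : ℕ} {f f₀ : Fin m → Label k n R} :
    view t f = view t f₀ ↔ f ∈ viewClass t f₀ := by
  constructor
  · intro h
    have := mem_viewClass_self t f
    rwa [viewClass, h] at this
  · intro h
    rw [mem_viewClass] at h
    funext e
    obtain ⟨h1, h2⟩ := h e
    by_cases h0 : ((f₀ e).1.1 : ℕ) < t
    · simp [view, h1 h0]
    · have := h2 (not_lt.1 h0)
      simp only [view, h0, not_lt.2 this, if_false]

theorem viewClass_succ_subset {t : ℕ} {f₀ f₁ : Fin m → Label k n R} (h₁ : f₁ ∈ viewClass t f₀) :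
    viewClass (t + 1) f₁ ⊆ viewClass t f₀ := by
  intro f hf
  rw [mem_viewClass] at *
  intro e
  obtain ⟨h1, h2⟩ := h₁ e
  obtain ⟨h3, h4⟩ := hf e
  constructor
  · intro h
    rw [h3 (by rw [h1 h]; omega), h1 h]
  · intro h
    have := h2 h
    by_cases h' : ((f₁ e).1.1 : ℕ) < t + 1
    · rw [h3 h']; exact this
    · have := h4 (by omega)
      omega

/-- The law of total probability: revealing level `t` splits a class into classes for `t + 1`, and a
bound on the mean over every part is a bound on the mean over the whole. -/
theorem sum_viewClass_le {t : ℕ} {f₀ : Fin m → Label k n R} {g : (Fin m → Label k n R) → ℝ≥0∞}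
    {D : ℝ≥0∞} (h : ∀ f₁ ∈ viewClass t f₀,
      ∑ f ∈ viewClass (t + 1) f₁, g f ≤ D * (viewClass (t + 1) f₁).card) :
    ∑ f ∈ viewClass t f₀, g f ≤ D * (viewClass t f₀).card := by
  classical
  have hfib : ∀ f₁ ∈ viewClass t f₀,
      ((viewClass t f₀).filter fun f => view (t + 1) f = view (t + 1) f₁) =
        viewClass (t + 1) f₁ := by
    intro f₁ h₁
    ext f
    rw [Finset.mem_filter, view_eq_iff]
    exact ⟨fun h => h.2, fun h => ⟨viewClass_succ_subset h₁ h, h⟩⟩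
  have hmaps : ∀ f ∈ viewClass t f₀, view (t + 1) f ∈ (viewClass t f₀).image (view (t + 1)) :=
    fun f hf => Finset.mem_image_of_mem _ hf
  rw [← Finset.sum_fiberwise_of_maps_to hmaps, Finset.card_eq_sum_card_fiberwise hmaps,
    Nat.cast_sum, Finset.mul_sum]
  refine Finset.sum_le_sum fun A hA => ?_
  obtain ⟨f₁, h₁, rfl⟩ := Finset.mem_image.1 hA
  rw [hfib f₁ h₁]
  exact h f₁ h₁

theorem truncatedOracle_eq {t : ℕ} {f f₁ : Fin m → Label k n R} (hf : f ∈ viewClass (t + 1) f₁)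
    (B : Finset (Fin m)) : truncatedOracle t f B = truncatedOracle t f₁ B := by
  rw [mem_viewClass] at hf
  have key : ∀ c : Color k n, (c.1 : ℕ) ≤ t → (ContainsColor f B c ↔ ContainsColor f₁ B c) := by
    intro c hc
    refine forall_congr' fun e => ?_
    obtain ⟨h1, h2⟩ := hf e
    by_cases h : ((f₁ e).1.1 : ℕ) < t + 1
    · rw [h1 h]
    · have h3 := h2 (not_lt.1 h)
      have h4 : (f₁ e).1 ≠ c := by rintro rfl; omega
      have h5 : (f e).1 ≠ c := by rintro rfl; omega
      simp [h4, h5]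
  rw [truncatedOracle, truncatedOracle, decide_eq_decide]
  exact forall_congr' fun c => forall_congr' fun hc => not_congr (key c hc)

/-- Fullness matters because `ContainsColor` holds vacuously for a colour that does not occur,
whereas an empty class is no circuit. -/
theorem labelMatroid_indep_iff {f : Fin m → Label k n R} (hf : IsFull f) (B : Finset (Fin m)) :
    (labelMatroid f).Indep B ↔ ∀ c : Color k n, ¬ ContainsColor f B c := by
  rw [labelMatroid, fiberMatroid_indep]
  constructor
  · intro h c hc
    obtain ⟨a, rfl⟩ := hf c
    obtain ⟨b, hb, hbB⟩ := h a
    exact hbB (hc b hb)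
  · intro h a
    by_contra! hcon
    exact h (f a).1 fun e he => hcon e he

theorem oracle_eq_truncatedOracle {t : ℕ} {f₀ f : Fin m → Label k n R} (hf : IsFull f)
    (hf₀ : f ∈ viewClass t f₀) {B : Finset (Fin m)} (hB : f ∉ mismatch t f₀ B) :
    oracle (labelMatroid f) B = truncatedOracle t f B := by
  classical
  rw [oracle, truncatedOracle, decide_eq_decide, labelMatroid_indep_iff hf]
  constructor
  · exact fun h c _ => h c
  · intro h c hc
    by_cases hct : (c.1 : ℕ) ≤ t
    · exact h c hct hc
    · exact hB (Finset.mem_filter.2 ⟨hf₀, ⟨c, not_le.1 hct, hc⟩, h⟩)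

open Classical in
/-- In a class of labellings in which at least `j + 1` levels are unrevealed, a computation is
unlikely to succeed within `j` rounds. -/
theorem sum_successProb_le {q : ℕ} (H : DecisionTree m q) {δ : ℝ≥0∞}
    (hδ : ∀ t < k, ∀ (f₀ : Fin m → Label k n R) (B : Finset (Fin m)),
      ((mismatch t f₀ B).card : ℝ≥0∞) ≤ δ * (viewClass t f₀).card)
    (hδ' : ∀ t < k, ∀ (f₀ : Fin m → Label k n R) (B : Finset (Fin m)),
      (((viewClass t f₀).filter fun f => IsFull f ∧ (labelMatroid f).IsBase B).card : ℝ≥0∞) ≤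
        δ * (viewClass t f₀).card) (N : ℕ) :
    ∀ (t j : ℕ) (_ : t + j < k) (f₀ : Fin m → Label k n R) (x : H.N),
      ∑ f ∈ viewClass t f₀, (if IsFull f then H.successProb (labelMatroid f) N j x else 0) ≤
        ((j * q + 1 : ℕ) * δ) * (viewClass t f₀).card := by
  induction N with
  | zero => simp [DecisionTree.successProb]
  | succ N ih =>
    intro t j htj f₀ x
    simp only [DecisionTree.successProb]
    cases hnode : H.node x with
    | leaf B =>
      dsimp only
      simp only [← ite_and]
      rw [Finset.sum_boole]
      refine (hδ' t (by omega) f₀ B).trans ?_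
      gcongr
      rw [← one_mul δ, ← mul_assoc, mul_one]
      gcongr
      exact_mod_cast Nat.le_add_left 1 _
    | random b next =>
      dsimp only
      have : ∀ f : Fin m → Label k n R,
          (if IsFull f then (∑ i, H.successProb (labelMatroid f) N j (next i)) /
            ((b + 1 : ℕ) : ℝ≥0∞) else 0) =
          (∑ i, (if IsFull f then H.successProb (labelMatroid f) N j (next i) else 0)) /
            ((b + 1 : ℕ) : ℝ≥0∞) := by
        intro f
        split_ifs <;> simp
      simp only [this]
      simp only [div_eq_mul_inv]
      rw [← Finset.sum_mul, Finset.sum_comm, ← div_eq_mul_inv]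
      exact DecisionTree.sum_div_le_of_le fun i => ih t j htj f₀ (next i)
    | query Q next =>
      cases j with
      | zero => simp
      | succ j =>
        dsimp only
        -- The true answers are replaced by the truncated ones; a labelling for which some answer
        -- differs is charged the trivial bound `1`. Summed over the class, the `q` queries cost `q
        -- * δ` times its size.
        have hpt : ∀ f ∈ viewClass t f₀,
            (if IsFull f then H.successProb (labelMatroid f) N j
              (next fun i => oracle (labelMatroid f) (Q i)) else 0) ≤
            (∑ i, if f ∈ mismatch t f₀ (Q i) then (1 : ℝ≥0∞) else 0) +
            (if IsFull f then H.successProb (labelMatroid f) N j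
              (next fun i => truncatedOracle t f (Q i)) else 0) := by
          intro f hf
          by_cases hfull : IsFull f
          · by_cases hm : ∃ i, f ∈ mismatch t f₀ (Q i)
            · obtain ⟨i, hi⟩ := hm
              refine le_trans ?_ le_self_add
              rw [if_pos hfull]
              refine (H.successProb_le_one _ _ _ _).trans ?_
              refine le_trans ?_ (Finset.single_le_sum (fun _ _ => zero_le) (Finset.mem_univ i))
              rw [if_pos hi]
            · push Not at hm
              refine le_trans (le_of_eq ?_) le_add_self
              have : (fun i => oracle (labelMatroid f) (Q i)) =
                  fun i => truncatedOracle t f (Q i) :=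
                funext fun i => oracle_eq_truncatedOracle hfull hf (hm i)
              rw [this]
          · simp [hfull]
        refine (Finset.sum_le_sum hpt).trans ?_
        rw [Finset.sum_add_distrib, Finset.sum_comm]
        have h1 : ∑ i, ∑ f ∈ viewClass t f₀, (if f ∈ mismatch t f₀ (Q i) then (1 : ℝ≥0∞) else 0) ≤
            q * (δ * (viewClass t f₀).card) := by
          calc _ ≤ ∑ _i : Fin q, δ * ((viewClass t f₀).card : ℝ≥0∞) := by
                refine Finset.sum_le_sum fun i _ => ?_
                rw [Finset.sum_boole]
                refine le_trans ?_ (hδ t (by omega) f₀ (Q i))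
                exact_mod_cast Finset.card_le_card fun f hf => (Finset.mem_filter.1 hf).2
            _ = _ := by simp
        have h2 : ∑ f ∈ viewClass t f₀, (if IsFull f then H.successProb (labelMatroid f) N j
              (next fun i => truncatedOracle t f (Q i)) else 0) ≤
            ((j * q + 1 : ℕ) * δ) * (viewClass t f₀).card := by
          -- Truncated answers are constant once level `t` is revealed, so on each finer class the
          -- computation proceeds to one fixed child, with one query fewer and `t + 1` in place of
          -- `t`.
          refine sum_viewClass_le fun f₁ _ => ?_
          refine le_trans (le_of_eq ?_)
            (ih (t + 1) j (by omega) f₁ (next fun i => truncatedOracle t f₁ (Q i)))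
          refine Finset.sum_congr rfl fun f hf => ?_
          have : (fun i => truncatedOracle t f (Q i)) = fun i => truncatedOracle t f₁ (Q i) :=
            funext fun i => truncatedOracle_eq hf _
          rw [this]
        refine (add_le_add h1 h2).trans (le_of_eq ?_)
        push_cast
        ring

end Labelling

/-! ### Probability estimates for a single query or output. -/

section Estimates

variable {m k n R : ℕ}

theorem card_filter_upperLabels {t : ℕ} {c : Color k n} (hc : t ≤ (c.1 : ℕ)) :
    ((upperLabels k n R t).filter fun l => l.1 = c).card = R ^ (c.1 : ℕ) := by
  have : ((upperLabels k n R t).filter fun l => l.1 = c) =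
      Finset.univ.map
        (Function.Embedding.sigmaMk (β := fun c : Color k n => Fin (R ^ (c.1 : ℕ))) c) := by
    ext l
    simp only [upperLabels, Finset.mem_filter, Finset.mem_univ, true_and, Finset.mem_map,
      Function.Embedding.sigmaMk_apply]
    constructor
    · rintro ⟨-, rfl⟩
      exact ⟨l.2, rfl⟩
    · rintro ⟨i, rfl⟩
      exact ⟨hc, rfl⟩
  rw [this, Finset.card_map, Finset.card_univ, Fintype.card_fin]

/-- The colours of level at least `t`. -/
def upperColors (k n t : ℕ) : Finset (Color k n) := Finset.univ.filter fun c => t ≤ (c.1 : ℕ)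

theorem mem_upperColors {t : ℕ} {c : Color k n} : c ∈ upperColors k n t ↔ t ≤ (c.1 : ℕ) := by
  simp [upperColors]

theorem card_upperLabels (t : ℕ) :
    (upperLabels k n R t).card = ∑ c ∈ upperColors k n t, R ^ (c.1 : ℕ) := by
  rw [Finset.card_eq_sum_card_fiberwise (f := fun l => l.1) (t := upperColors k n t)]
  · exact Finset.sum_congr rfl fun c hc => card_filter_upperLabels (mem_upperColors.1 hc)
  · intro l hl
    simpa [upperLabels, upperColors] using hl

/-- The colours of level `t`. -/
def levelColors (n : ℕ) {k t : ℕ} (ht : t < k) : Finset (Color k n) := {⟨t, ht⟩} ×ˢ Finset.univ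

theorem mem_levelColors {t : ℕ} {ht : t < k} {c : Color k n} :
    c ∈ levelColors n ht ↔ (c.1 : ℕ) = t := by
  simp only [levelColors, Finset.mem_product, Finset.mem_singleton, Finset.mem_univ, and_true,
    Fin.ext_iff]

theorem card_levelColors {t : ℕ} (ht : t < k) : (levelColors n ht).card = n := by
  simp [levelColors]

theorem le_card_upperColors {t : ℕ} (ht : t < k) : n ≤ (upperColors k n t).card := by
  refine (card_levelColors (n := n) ht).ge.trans ?_
  exact Finset.card_le_card fun c hc => mem_upperColors.2 (mem_levelColors.1 hc).ge

theorem card_upperColors_mul_le (hR : 1 ≤ R) (t : ℕ) :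
    (upperColors k n t).card * R ^ t ≤ (upperLabels k n R t).card := by
  rw [card_upperLabels, ← smul_eq_mul, ← Finset.sum_const]
  exact Finset.sum_le_sum fun c hc => Nat.pow_le_pow_right hR (mem_upperColors.1 hc)

theorem card_upperLabels_le (hR : 1 ≤ R) : (upperLabels k n R 0).card ≤ k * n * R ^ k := by
  rw [card_upperLabels]
  calc _ ≤ ∑ c ∈ upperColors k n 0, R ^ k :=
        Finset.sum_le_sum fun c _ => Nat.pow_le_pow_right hR c.1.2.le
    _ = (upperColors k n 0).card * R ^ k := by rw [Finset.sum_const, smul_eq_mul]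
    _ ≤ k * n * R ^ k := by
      gcongr
      exact (Finset.card_le_univ _).trans (by simp)

/-- The elements outside `B` that are not revealed. -/
def hidden (t : ℕ) (f₀ : Fin m → Label k n R) (B : Finset (Fin m)) : Finset (Fin m) :=
  Bᶜ.filter fun e => t ≤ ((f₀ e).1.1 : ℕ)

theorem view_eq_of_mem_hidden {t : ℕ} {f₀ : Fin m → Label k n R} {B : Finset (Fin m)} {e : Fin m}
    (he : e ∈ hidden t f₀ B) : view t f₀ e = upperLabels k n R t :=
  if_neg (not_lt.2 (Finset.mem_filter.1 he).2)

theorem containsColor_iff {t : ℕ} {f f₀ : Fin m → Label k n R} (hf : f ∈ viewClass t f₀)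
    {B : Finset (Fin m)} {c : Color k n} (hc : t ≤ (c.1 : ℕ)) :
    ContainsColor f B c ↔ ∀ e ∈ hidden t f₀ B, (f e).1 ≠ c := by
  constructor
  · intro h e he hec
    exact Finset.mem_compl.1 (Finset.mem_filter.1 he).1 (h e hec)
  · intro h e hec
    by_contra heB
    refine h e (Finset.mem_filter.2 ⟨Finset.mem_compl.2 heB, ?_⟩) hec
    by_contra hlt
    have := ((mem_viewClass.1 hf) e).1 (not_le.1 hlt)
    rw [← this, hec] at hlt
    exact hlt hc

/-- The chance that a hidden element has a given colour of level `t`. -/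
noncomputable def levelProb (k n R t : ℕ) : ℝ := (R : ℝ) ^ t / (upperLabels k n R t).card

theorem card_upperLabels_pos {t : ℕ} (hR : 1 ≤ R) (ht : t < k) (hn : 1 ≤ n) : 0 < (upperLabels k n R t).card :=
  lt_of_lt_of_le (Nat.mul_pos (hn.trans (le_card_upperColors ht)) (Nat.pow_pos hR))
    (card_upperColors_mul_le hR t)

theorem levelProb_nonneg (k n R t : ℕ) : 0 ≤ levelProb k n R t := by
  unfold levelProb; positivity

theorem levelProb_mul_card_le {t : ℕ} (hR : 1 ≤ R) (ht : t < k) (hn : 1 ≤ n) :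
    levelProb k n R t * (upperColors k n t).card ≤ 1 := by
  have h := card_upperLabels_pos (k := k) (n := n) hR ht hn
  have h' : (0 : ℝ) < (upperLabels k n R t).card := by exact_mod_cast h
  rw [levelProb, div_mul_eq_mul_div, div_le_one h', mul_comm]
  exact_mod_cast card_upperColors_mul_le hR t

theorem levelProb_mul_le {t : ℕ} (hR : 1 ≤ R) (ht : t < k) (hn : 1 ≤ n) : levelProb k n R t * n ≤ 1 :=
  (mul_le_mul_of_nonneg_left (by exact_mod_cast le_card_upperColors ht)
    (levelProb_nonneg k n R t)).trans (levelProb_mul_card_le hR ht hn)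

theorem levelProb_le_one {t : ℕ} (hR : 1 ≤ R) (ht : t < k) (hn : 1 ≤ n) : levelProb k n R t ≤ 1 := by
  have h := levelProb_mul_le (k := k) (n := n) hR ht hn
  have h' : (1 : ℝ) ≤ n := by exact_mod_cast hn
  nlinarith [levelProb_nonneg k n R t]

open Classical in
/-- If `B` misses few hidden elements, then it contains some colour class of level `t`. -/
theorem card_filter_forall_not_containsColor_le {t : ℕ} (hR : 1 ≤ R) (ht : t < k) (hn : 1 ≤ n) {N : ℕ} (hN : 1 ≤ N) (hnN : n = N ^ 2)
    (f₀ : Fin m → Label k n R) (B : Finset (Fin m))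
    (hB : 1 / (N : ℝ) ≤ (1 - levelProb k n R t) ^ (hidden t f₀ B).card) :
    (((viewClass t f₀).filter fun f => ∀ c : Color k n, (c.1 : ℕ) = t →
      ¬ ContainsColor f B c).card : ℝ) ≤ Real.exp (-N) * (viewClass t f₀).card := by
  have hS := card_upperLabels_pos (k := k) (n := n) hR ht hn
  have hS' : (0 : ℝ) < (upperLabels k n R t).card := by exact_mod_cast hS
  have hp0 := levelProb_nonneg k n R t
  have hp1 := levelProb_le_one (k := k) (n := n) hR ht hn
  have hJ : ∀ j ∈ levelColors n ht, (((upperLabels k n R t).filter fun l => l.1 = j).card : ℝ) =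
      levelProb k n R t * (upperLabels k n R t).card := by
    intro j hj
    rw [card_filter_upperLabels (mem_levelColors.1 hj).ge, mem_levelColors.1 hj, levelProb,
      div_mul_cancel₀ _ hS'.ne']
    push_cast
    rfl
  have h : (((Fintype.piFinset (view t f₀)).filter
      fun f => ∀ j ∈ levelColors n ht, ∃ e ∈ hidden t f₀ B, (f e).1 = j).card : ℝ) ≤
      (1 - (1 - levelProb k n R t) ^ (hidden t f₀ B).card) ^ (levelColors n ht).card *
        (Fintype.piFinset (view t f₀)).card := by
    convert card_filter_forall_exists_le (fun l : Label k n R => l.1) (upperLabels k n R t) hS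
      hp0 hp1 (hidden t f₀ B) (view t f₀) (fun e he => view_eq_of_mem_hidden he) (levelColors n ht)
      hJ
  refine le_trans ?_ (h.trans ?_)
  · refine Nat.cast_le.2 (Finset.card_le_card fun f hf => ?_)
    rw [Finset.mem_filter] at hf
    refine Finset.mem_filter.2 ⟨hf.1, fun j hj => ?_⟩
    have := hf.2 j (mem_levelColors.1 hj)
    rw [containsColor_iff hf.1 (mem_levelColors.1 hj).ge] at this
    push Not at this
    exact this
  refine mul_le_mul_of_nonneg_right ?_ (Nat.cast_nonneg _)
  have hN' : (0 : ℝ) < N := by exact_mod_cast hN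
  rw [card_levelColors]
  -- The choice `n = N ^ 2` makes `(1 - 1 / N) ^ n` at most `exp (-N)`.
  calc (1 - (1 - levelProb k n R t) ^ (hidden t f₀ B).card) ^ n
      ≤ (Real.exp (-(1 / N))) ^ n := by
        refine pow_le_pow_left₀ (sub_nonneg.2 (pow_le_one₀ (by linarith) (by linarith))) ?_ n
        have := Real.add_one_le_exp (-(1 / (N : ℝ)))
        linarith
    _ = Real.exp (-N) := by
        rw [← Real.exp_nat_mul, hnN]
        congr 1
        push_cast
        field_simp

open Classical in
/-- If `B` misses many hidden elements, then it contains no given colour class of higher level. -/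
theorem card_filter_containsColor_le {t : ℕ} (hR : 1 ≤ R) (ht : t < k) (hn : 1 ≤ n) {N : ℕ}
    (f₀ : Fin m → Label k n R) (B : Finset (Fin m))
    (hB : (1 - levelProb k n R t) ^ (hidden t f₀ B).card ≤ 1 / (N : ℝ)) {c : Color k n}
    (hc : t < (c.1 : ℕ)) :
    (((viewClass t f₀).filter fun f => ContainsColor f B c).card : ℝ) ≤
      (1 / (N : ℝ)) ^ R * (viewClass t f₀).card := by
  have hS := card_upperLabels_pos (k := k) (n := n) hR ht hn
  have hS' : (0 : ℝ) < (upperLabels k n R t).card := by exact_mod_cast hS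
  have hp0 := levelProb_nonneg k n R t
  have hp1 := levelProb_le_one (k := k) (n := n) hR ht hn
  set p : ℝ := (R : ℝ) ^ (c.1 : ℕ) / (upperLabels k n R t).card with hp
  have hpc : (((upperLabels k n R t).filter fun l => l.1 = c).card : ℝ) =
      p * (upperLabels k n R t).card := by
    rw [card_filter_upperLabels hc.le, hp, div_mul_cancel₀ _ hS'.ne']
    push_cast
    rfl
  have hple : p ≤ 1 := by
    have : (((upperLabels k n R t).filter fun l => l.1 = c).card : ℝ) ≤
      (upperLabels k n R t).card := by exact_mod_cast Finset.card_filter_le _ _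
    rw [hpc] at this
    nlinarith
  have h : (((Fintype.piFinset (view t f₀)).filter
      fun f => ∀ e ∈ hidden t f₀ B, (f e).1 ≠ c).card : ℝ) ≤
      (1 - p) ^ (hidden t f₀ B).card * (Fintype.piFinset (view t f₀)).card := by
    convert card_filter_forall_ne_le (fun l : Label k n R => l.1) (upperLabels k n R t) hS
      c hpc (hidden t f₀ B) (view t f₀) (fun e he => view_eq_of_mem_hidden he)
  refine le_trans ?_ (h.trans ?_)
  · refine Nat.cast_le.2 (Finset.card_le_card fun f hf => ?_)
    rw [Finset.mem_filter] at hf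
    exact Finset.mem_filter.2 ⟨hf.1, (containsColor_iff hf.1 hc.le).1 hf.2⟩
  refine mul_le_mul_of_nonneg_right ?_ (Nat.cast_nonneg _)
  -- A higher level is at least `R` times as heavy; with Bernoulli's inequality this gives `1 - p ≤
  -- (1 - levelProb k n R t) ^ R`, so the bound `1 / N` of `hB` is raised to the power `R`.
  have hRp : R * levelProb k n R t ≤ p := by
    rw [hp, levelProb, ← mul_div_assoc, ← pow_succ']
    gcongr
    · exact_mod_cast hR
    · omega
  have hbern : 1 - R * levelProb k n R t ≤ (1 - levelProb k n R t) ^ R := by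
    have := one_add_mul_le_pow (a := -levelProb k n R t) (by linarith) R
    rwa [mul_neg, ← sub_eq_add_neg, ← sub_eq_add_neg] at this
  calc (1 - p) ^ (hidden t f₀ B).card
      ≤ ((1 - levelProb k n R t) ^ R) ^ (hidden t f₀ B).card :=
        pow_le_pow_left₀ (by linarith) (by linarith) _
    _ = ((1 - levelProb k n R t) ^ (hidden t f₀ B).card) ^ R := by
        rw [← pow_mul, ← pow_mul, mul_comm]
    _ ≤ (1 / (N : ℝ)) ^ R := pow_le_pow_left₀ (pow_nonneg (by linarith) _) hB R

/-- A mismatch needs both that `B` contains no class of level `t` and that it contains some class of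
higher level. Depending on how many hidden elements `B` misses, the first or the second event is
unlikely; the second takes a union bound over at most `k * n` colours. -/
theorem card_mismatch_le {t : ℕ} (hR : 1 ≤ R) (ht : t < k) (hn : 1 ≤ n) {N : ℕ} (hN : 1 ≤ N) (hnN : n = N ^ 2)
    (f₀ : Fin m → Label k n R) (B : Finset (Fin m)) :
    ((mismatch t f₀ B).card : ℝ) ≤
      (Real.exp (-N) + k * n * (1 / (N : ℝ)) ^ R) * (viewClass t f₀).card := by
  classical
  rcases le_total (1 / (N : ℝ)) ((1 - levelProb k n R t) ^ (hidden t f₀ B).card) with h | h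
  · refine le_trans ?_ ((card_filter_forall_not_containsColor_le hR ht hn hN hnN f₀ B h).trans ?_)
    · refine Nat.cast_le.2 (Finset.card_le_card fun f hf => ?_)
      rw [mismatch, Finset.mem_filter] at hf
      exact Finset.mem_filter.2 ⟨hf.1, fun c hc => hf.2.2 c hc.le⟩
    · gcongr
      exact le_add_of_nonneg_right (by positivity)
  · have hsub : mismatch t f₀ B ⊆ (upperColors k n (t + 1)).biUnion
        fun c => (viewClass t f₀).filter fun f => ContainsColor f B c := by
      intro f hf
      rw [mismatch, Finset.mem_filter] at hf
      obtain ⟨c, hc, hcB⟩ := hf.2.1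
      exact Finset.mem_biUnion.2 ⟨c, mem_upperColors.2 hc, Finset.mem_filter.2 ⟨hf.1, hcB⟩⟩
    calc ((mismatch t f₀ B).card : ℝ)
        ≤ ∑ c ∈ upperColors k n (t + 1),
          (((viewClass t f₀).filter fun f => ContainsColor f B c).card : ℝ) := by
          exact_mod_cast (Finset.card_le_card hsub).trans Finset.card_biUnion_le
      _ ≤ ∑ c ∈ upperColors k n (t + 1), (1 / (N : ℝ)) ^ R * (viewClass t f₀).card :=
          Finset.sum_le_sum fun c hc =>
            card_filter_containsColor_le hR ht hn f₀ B h (mem_upperColors.1 hc)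
      _ = (upperColors k n (t + 1)).card * ((1 / (N : ℝ)) ^ R * (viewClass t f₀).card) := by
          rw [Finset.sum_const, nsmul_eq_mul]
      _ ≤ (k * n : ℕ) * ((1 / (N : ℝ)) ^ R * (viewClass t f₀).card) := by
          gcongr
          exact (Finset.card_le_univ _).trans (by simp)
      _ ≤ _ := by
          push_cast
          rw [← mul_assoc]
          gcongr
          exact le_add_of_nonneg_left (Real.exp_pos _).le

theorem exp_neg_two_mul_le {x : ℝ} (hx0 : 0 ≤ x) (hx : x ≤ 1 / 2) :
    Real.exp (-(2 * x)) ≤ 1 - x := by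
  rw [Real.exp_neg]
  refine inv_le_of_inv_le₀ (by linarith) ?_
  refine le_trans ?_ (Real.add_one_le_exp (2 * x))
  rw [inv_le_iff_one_le_mul₀ (by linarith)]
  nlinarith

open Classical in
theorem card_filter_isBase_le {t : ℕ} (hR : 1 ≤ R) (ht : t < k) (hn : 1 ≤ n) {N : ℕ} (hN : 8 ≤ N) (hnN : n = N ^ 2)
    (f₀ : Fin m → Label k n R) (B : Finset (Fin m)) :
    (((viewClass t f₀).filter fun f => IsFull f ∧ (labelMatroid f).IsBase B).card : ℝ) ≤
      Real.exp (-N) * (viewClass t f₀).card := by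
  have hp0 := levelProb_nonneg k n R t
  -- A single labelling of the class for which `B` is a base already bounds the size of `hidden t f₀
  -- B`, which is the same for the whole class: outside a base the colours are distinct.
  rcases Finset.eq_empty_or_nonempty
    ((viewClass t f₀).filter fun f => IsFull f ∧ (labelMatroid f).IsBase B) with h | ⟨f, hf⟩
  · rw [h]
    simp only [Finset.card_empty, Nat.cast_zero]
    positivity
  obtain ⟨hfc, -, hfB⟩ := Finset.mem_filter.1 hf
  have hcard : (hidden t f₀ B).card ≤ (upperColors k n t).card := by
    refine Finset.card_le_card_of_injOn (fun e => (f e).1) ?_ ?_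
    · intro e he
      exact mem_upperColors.2 (((mem_viewClass.1 hfc) e).2 (Finset.mem_filter.1 he).2)
    · have := injOn_compl_of_isBase_fiberMatroid hfB
      refine this.mono fun e he => ?_
      simpa using Finset.mem_compl.1 (Finset.mem_filter.1 he).1
  have hpw : levelProb k n R t * (hidden t f₀ B).card ≤ 1 :=
    (mul_le_mul_of_nonneg_left (by exact_mod_cast hcard) hp0).trans
      (levelProb_mul_card_le hR ht hn)
  have hhalf : levelProb k n R t ≤ 1 / 2 := by
    have h1 := levelProb_mul_le (k := k) (n := n) hR ht hn
    have h2 : (2 : ℝ) ≤ n := by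
      have : 2 ≤ n := by rw [hnN]; nlinarith
      exact_mod_cast this
    nlinarith
  have hN8 : (8 : ℝ) ≤ N := by exact_mod_cast hN
  -- The mean number of hidden elements outside `B` of a given colour of level `t` is at most `1`,
  -- so the power is at least `exp (-2) ≥ 1 / 8`; hence the hypothesis `8 ≤ N`.
  have hB : 1 / (N : ℝ) ≤ (1 - levelProb k n R t) ^ (hidden t f₀ B).card := by
    calc 1 / (N : ℝ) ≤ 1 / 8 := by gcongr
      _ ≤ Real.exp (-2) := by
        rw [Real.exp_neg, one_div]
        gcongr
        have h1 := Real.exp_one_lt_d9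
        have : Real.exp 2 = Real.exp 1 * Real.exp 1 := by rw [← Real.exp_add]; norm_num
        rw [this]
        nlinarith [Real.exp_pos 1]
      _ ≤ (Real.exp (-(2 * levelProb k n R t))) ^ (hidden t f₀ B).card := by
        rw [← Real.exp_nat_mul]
        gcongr
        nlinarith
      _ ≤ _ := pow_le_pow_left₀ (Real.exp_pos _).le (exp_neg_two_mul_le hp0 hhalf) _
  refine le_trans ?_
    (card_filter_forall_not_containsColor_le hR ht hn (by omega) hnN f₀ B hB)
  refine Nat.cast_le.2 (Finset.card_le_card fun f hf => ?_)
  rw [Finset.mem_filter] at hf ⊢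
  exact ⟨hf.1, fun c _ => (labelMatroid_indep_iff hf.2.1 B).1 hf.2.2.indep c⟩

theorem viewClass_zero (f₀ : Fin m → Label k n R) : viewClass 0 f₀ = Finset.univ := by
  ext f
  simp [mem_viewClass]

-- Even the lightest colour has expected class size at least `N`, so it is absent with probability
-- at most `exp (-N)`; a union bound over the `k * n` colours follows.
open Classical in
theorem card_filter_not_isFull_le (hR : 1 ≤ R) (hn : 1 ≤ n) {N : ℕ}
    (hm : N * (k * n * R ^ k) ≤ m) :
    ((Finset.univ.filter fun f : Fin m → Label k n R => ¬ IsFull f).card : ℝ) ≤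
      k * n * Real.exp (-N) * Fintype.card (Fin m → Label k n R) := by
  have hsub : (Finset.univ.filter fun f : Fin m → Label k n R => ¬ IsFull f) ⊆
      (Finset.univ : Finset (Color k n)).biUnion fun c =>
        Finset.univ.filter fun f : Fin m → Label k n R => ∀ e, (f e).1 ≠ c := by
    intro f hf
    rw [Finset.mem_filter, IsFull] at hf
    have := hf.2
    push Not at this
    obtain ⟨c, hc⟩ := this
    refine Finset.mem_biUnion.2 ⟨c, Finset.mem_univ _, Finset.mem_filter.2 ⟨Finset.mem_univ _, hc⟩⟩
  have hone : ∀ c : Color k n,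
      ((Finset.univ.filter fun f : Fin m → Label k n R => ∀ e, (f e).1 ≠ c).card : ℝ) ≤
        Real.exp (-N) * Fintype.card (Fin m → Label k n R) := by
    intro c
    have hk : 0 < k := c.1.pos
    have hS := card_upperLabels_pos (k := k) (n := n) hR hk hn
    have hS' : (0 : ℝ) < (upperLabels k n R 0).card := by exact_mod_cast hS
    set p : ℝ := (R : ℝ) ^ (c.1 : ℕ) / (upperLabels k n R 0).card with hp
    have hpc : (((upperLabels k n R 0).filter fun l => l.1 = c).card : ℝ) =
        p * (upperLabels k n R 0).card := by
      rw [card_filter_upperLabels (Nat.zero_le _), hp, div_mul_cancel₀ _ hS'.ne']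
      push_cast
      rfl
    have hple : p ≤ 1 := by
      have : (((upperLabels k n R 0).filter fun l => l.1 = c).card : ℝ) ≤
        (upperLabels k n R 0).card := by exact_mod_cast Finset.card_filter_le _ _
      rw [hpc] at this
      nlinarith
    have h : (((Fintype.piFinset fun _ : Fin m => upperLabels k n R 0).filter
        fun f => ∀ e ∈ Finset.univ, (f e).1 ≠ c).card : ℝ) ≤
        (1 - p) ^ (Finset.univ : Finset (Fin m)).card *
          (Fintype.piFinset fun _ : Fin m => upperLabels k n R 0).card := by
      convert card_filter_forall_ne_le (fun l : Label k n R => l.1) (upperLabels k n R 0) hS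
        c hpc (Finset.univ : Finset (Fin m)) (fun _ => upperLabels k n R 0) (fun _ _ => rfl)
    refine le_trans ?_ (h.trans ?_)
    · refine Nat.cast_le.2 (Finset.card_le_card fun f hf => ?_)
      refine Finset.mem_filter.2 ⟨?_, fun e _ => (Finset.mem_filter.1 hf).2 e⟩
      rw [Fintype.mem_piFinset]
      intro e
      simp [upperLabels]
    have hu : (Fintype.piFinset fun _ : Fin m => upperLabels k n R 0).card ≤
        Fintype.card (Fin m → Label k n R) := Finset.card_le_univ _
    refine mul_le_mul ?_ (by exact_mod_cast hu) (Nat.cast_nonneg _) (Real.exp_pos _).le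
    have hmp : (N : ℝ) ≤ m * p := by
      rw [hp, ← mul_div_assoc, le_div_iff₀ hS']
      have h1 : N * (upperLabels k n R 0).card ≤ m * R ^ (c.1 : ℕ) :=
        ((Nat.mul_le_mul_left N (card_upperLabels_le hR)).trans hm).trans
          (Nat.le_mul_of_pos_right m (Nat.pow_pos hR))
      exact_mod_cast h1
    calc (1 - p) ^ (Finset.univ : Finset (Fin m)).card
        ≤ (Real.exp (-p)) ^ (Finset.univ : Finset (Fin m)).card :=
          pow_le_pow_left₀ (by linarith) (by linarith [Real.add_one_le_exp (-p)]) _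
      _ = Real.exp (-(m * p)) := by
          rw [← Real.exp_nat_mul, Finset.card_univ, Fintype.card_fin, mul_neg]
      _ ≤ Real.exp (-N) := by gcongr
  calc _ ≤ ∑ c : Color k n, ((Finset.univ.filter fun f : Fin m → Label k n R => ∀ e, (f e).1 ≠ c).card : ℝ) := by
        exact_mod_cast (Finset.card_le_card hsub).trans Finset.card_biUnion_le
    _ ≤ ∑ _c : Color k n, Real.exp (-N) * Fintype.card (Fin m → Label k n R) :=
        Finset.sum_le_sum fun c _ => hone c
    _ = _ := by
        rw [Finset.sum_const, nsmul_eq_mul, Finset.card_univ, Fintype.card_prod, Fintype.card_fin,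
          Fintype.card_fin]
        push_cast
        ring

end Estimates

/-! ### Averaging over labellings and choice of parameters. -/

section LowerBound

variable {m k n R q : ℕ}

theorem isGraphicOn_labelMatroid (f : Fin m → Label k n R) : IsGraphicOn m (labelMatroid f) :=
  isGraphicOn_fiberMatroid _

open Classical in
/-- If few labellings are atypical, then every tree needs `k / 2` rounds in expectation on the
matroid of some labelling. -/
theorem half_le_worstCaseRounds (hk : 1 ≤ k) (hn : 1 ≤ n) (hR : 1 ≤ R)
    (H : DecisionTree m q) (hH : H.Solves) {δ β : ℝ≥0∞}
    (hδ : ∀ t < k, ∀ (f₀ : Fin m → Label k n R) (B : Finset (Fin m)),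
      ((mismatch t f₀ B).card : ℝ≥0∞) ≤ δ * (viewClass t f₀).card)
    (hδ' : ∀ t < k, ∀ (f₀ : Fin m → Label k n R) (B : Finset (Fin m)),
      (((viewClass t f₀).filter fun f => IsFull f ∧ (labelMatroid f).IsBase B).card : ℝ≥0∞) ≤
        δ * (viewClass t f₀).card)
    (hβ : ((Finset.univ.filter fun f : Fin m → Label k n R => ¬ IsFull f).card : ℝ≥0∞) ≤
      β * Fintype.card (Fin m → Label k n R))
    (hsmall : (k * q + 1 : ℕ) * δ + β ≤ 1 / 2) :
    (k : ℝ≥0∞) / 2 ≤ H.worstCaseRounds := by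
  set Ω : ℝ≥0∞ := (Fintype.card (Fin m → Label k n R) : ℝ≥0∞) with hΩ
  set ρ := H.worstCaseRounds with hρ
  have f₀ : Fin m → Label k n R := fun _ => ⟨(⟨0, hk⟩, ⟨0, hn⟩), ⟨0, Nat.pow_pos hR⟩⟩
  have hΩ0 : Ω ≠ 0 := by
    have : Nonempty (Fin m → Label k n R) := ⟨f₀⟩
    simp only [hΩ, ne_eq, Nat.cast_eq_zero]
    exact Fintype.card_ne_zero
  have hΩt : Ω ≠ ∞ := ENNReal.natCast_ne_top _
  set F : Finset (Fin m → Label k n R) := Finset.univ.filter IsFull with hF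
  have hround : ∀ N, ∀ f : Fin m → Label k n R,
      H.roundsUpTo (labelMatroid f) N H.root ≤ ρ := by
    intro N f
    exact (le_iSup (fun N => H.roundsUpTo (labelMatroid f) N H.root) N).trans
      (le_iSup₂ (f := fun (M : Matroid (Fin m)) (_ : IsGraphicOn m M) => H.expectedRounds M)
        (labelMatroid f) (isGraphicOn_labelMatroid _))
  have hstep : ∀ N, ∑ f ∈ F, (k : ℝ≥0∞) * H.haltProb (labelMatroid f) N H.root ≤
      k * ((k * q + 1 : ℕ) * δ * Ω) + Ω * ρ := by
    intro N
    -- With `k - 1` queries allowed, one level stays hidden to the end, as `sum_successProb_le`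
    -- requires.
    obtain ⟨j, rfl⟩ : ∃ j, k = j + 1 := ⟨k - 1, by omega⟩
    calc _ ≤ ∑ f ∈ F, (((j + 1 : ℕ) : ℝ≥0∞) * H.successProb (labelMatroid f) N j H.root +
          H.roundsUpTo (labelMatroid f) N H.root) :=
          Finset.sum_le_sum fun f _ => H.mul_haltProb_le _ N j H.root
            (hH _ (isGraphicOn_labelMatroid _)).2
      _ = ((j + 1 : ℕ) : ℝ≥0∞) * ∑ f ∈ F, H.successProb (labelMatroid f) N j H.root +
          ∑ f ∈ F, H.roundsUpTo (labelMatroid f) N H.root := by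
          rw [Finset.sum_add_distrib, Finset.mul_sum]
      _ ≤ _ := by
          gcongr
          · have := sum_successProb_le H hδ hδ' N 0 j (by omega) f₀ H.root
            rw [viewClass_zero, ← Finset.sum_filter, Finset.card_univ] at this
            refine this.trans ?_
            gcongr
            omega
          · calc _ ≤ ∑ _f ∈ F, ρ := Finset.sum_le_sum fun f _ => hround N f
              _ = (F.card : ℝ≥0∞) * ρ := by rw [Finset.sum_const, nsmul_eq_mul]
              _ ≤ _ := by
                gcongr
                exact Nat.cast_le.2 (Finset.card_le_univ F)
  have hmono : ∀ f : Fin m → Label k n R,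
      Monotone fun N => (k : ℝ≥0∞) * H.haltProb (labelMatroid f) N H.root := by
    intro f
    exact monotone_nat_of_le_succ fun N => by
      gcongr
      exact H.haltProb_le_succ _ N _
  have hlim : (k : ℝ≥0∞) * F.card ≤ k * ((k * q + 1 : ℕ) * δ * Ω) + Ω * ρ := by
    -- Halting is only almost sure, so the bound for depth `N` is passed to the limit by monotone
    -- convergence over the finite set `F`.
    have h1 : ∑ f ∈ F, ⨆ N, (k : ℝ≥0∞) * H.haltProb (labelMatroid f) N H.root =
        ⨆ N, ∑ f ∈ F, (k : ℝ≥0∞) * H.haltProb (labelMatroid f) N H.root :=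
      ENNReal.finsetSum_iSup_of_monotone hmono
    have h2 : ∑ f ∈ F, ⨆ N, (k : ℝ≥0∞) * H.haltProb (labelMatroid f) N H.root = k * F.card := by
      rw [Finset.sum_congr rfl (g := fun _ => (k : ℝ≥0∞)), Finset.sum_const, nsmul_eq_mul, mul_comm]
      intro f _
      rw [← ENNReal.mul_iSup, (hH _ (isGraphicOn_labelMatroid _)).1, mul_one]
    rw [← h2, h1]
    exact iSup_le hstep
  have hsplit : Ω ≤ F.card + β * Ω := by
    have h1 := Finset.card_filter_add_card_filter_not
      (s := (Finset.univ : Finset (Fin m → Label k n R))) IsFull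
    rw [Finset.card_univ] at h1
    calc Ω = (F.card : ℝ≥0∞) +
          (Finset.univ.filter fun f : Fin m → Label k n R => ¬ IsFull f).card := by
          rw [hΩ, ← h1, Nat.cast_add]
      _ ≤ _ := by gcongr
  have hmain : (k : ℝ≥0∞) * Ω ≤ (k / 2 + ρ) * Ω := by
    calc (k : ℝ≥0∞) * Ω ≤ k * (F.card + β * Ω) := by gcongr
      _ = k * F.card + k * (β * Ω) := mul_add _ _ _
      _ ≤ k * ((k * q + 1 : ℕ) * δ * Ω) + Ω * ρ + k * (β * Ω) := by gcongr
      _ = k * (((k * q + 1 : ℕ) * δ + β) * Ω) + Ω * ρ := by ring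
      _ ≤ k * (1 / 2 * Ω) + Ω * ρ := by gcongr
      _ = (k / 2 + ρ) * Ω := by rw [one_div, ENNReal.div_eq_inv_mul]; ring
  have hk2 : (k : ℝ≥0∞) ≤ k / 2 + ρ := (ENNReal.mul_le_mul_iff_left hΩ0 hΩt).1 hmain
  have hhalf : (k : ℝ≥0∞) / 2 ≠ ∞ := ENNReal.div_ne_top (ENNReal.natCast_ne_top _) (by norm_num)
  rw [← ENNReal.add_halves (k : ℝ≥0∞)] at hk2
  exact (ENNReal.add_le_add_iff_left (by simpa using hhalf)).1 (by simpa using hk2)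

theorem natCast_card_le_ofReal_mul {a b : ℕ} {x : ℝ} (hx : 0 ≤ x) (h : (a : ℝ) ≤ x * b) :
    (a : ℝ≥0∞) ≤ ENNReal.ofReal x * b := by
  rw [← ENNReal.ofReal_natCast, ← ENNReal.ofReal_natCast b, ← ENNReal.ofReal_mul hx]
  exact ENNReal.ofReal_le_ofReal h

/-- The lower bound, with all parameters expressed through `N`. -/
theorem half_le_probRounds {N d : ℕ} (hN : 8 ≤ N)
    (hexp : Real.exp (-N) ≤ 1 / (N : ℝ) ^ (d + 4)) (hk : 1 ≤ k) (hR : R = d + 6)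
    (hkN : R ^ k ≤ N) (hq : q ≤ N ^ d) (hm : N ^ 8 ≤ m) :
    (k : ℝ≥0∞) / 2 ≤ probRounds m q := by
  have hR1 : 1 ≤ R := by omega
  have hkN' : k ≤ N := (Nat.lt_pow_self (by omega)).le.trans hkN
  have hN1 : 1 ≤ N := by omega
  have hn : 1 ≤ N ^ 2 := Nat.pow_pos hN1
  have hN8 : (8 : ℝ) ≤ N := by exact_mod_cast hN
  have hN0 : (0 : ℝ) < N := by linarith
  have hkr : (k : ℝ) ≤ N := by exact_mod_cast hkN'
  have hqr : (q : ℝ) ≤ (N : ℝ) ^ d := by exact_mod_cast hq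
  set δ : ℝ := Real.exp (-N) + k * (N ^ 2 : ℕ) * (1 / (N : ℝ)) ^ R with hδ
  set β : ℝ := k * (N ^ 2 : ℕ) * Real.exp (-N) with hβ
  have hδ0 : 0 ≤ δ := by positivity
  have hβ0 : 0 ≤ β := by positivity
  -- The choice `R = d + 6` turns `k * N ^ 2 ≤ N ^ 3` bad colours into a total of `N ^ (-(d + 3))`,
  -- small enough to survive a union bound over at most `N ^ (d + 1)` queries.
  have hδle : δ ≤ 2 / (N : ℝ) ^ (d + 3) := by
    have h1 : 1 / (N : ℝ) ^ (d + 4) ≤ 1 / (N : ℝ) ^ (d + 3) := by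
      gcongr
      · linarith
      · omega
    have h2 : (k : ℝ) * (N ^ 2 : ℕ) * (1 / (N : ℝ)) ^ R ≤ 1 / (N : ℝ) ^ (d + 3) := by
      calc (k : ℝ) * (N ^ 2 : ℕ) * (1 / (N : ℝ)) ^ R
          ≤ N * (N ^ 2 : ℕ) * (1 / (N : ℝ)) ^ R := by gcongr
        _ = 1 / (N : ℝ) ^ (d + 3) := by
          rw [hR, one_div_pow]
          push_cast
          field_simp
          ring
    have h3 : 2 / (N : ℝ) ^ (d + 3) = 1 / (N : ℝ) ^ (d + 3) + 1 / (N : ℝ) ^ (d + 3) := by ring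
    rw [h3]
    exact add_le_add (hexp.trans h1) h2
  have hβle : β ≤ 1 / 8 := by
    calc β ≤ N * (N ^ 2 : ℕ) * (1 / (N : ℝ) ^ (d + 4)) := by rw [hβ]; gcongr
      _ = 1 / (N : ℝ) ^ (d + 1) := by
        push_cast
        field_simp
        ring
      _ ≤ 1 / (N : ℝ) ^ 1 := by
        gcongr
        · linarith
        · omega
      _ ≤ 1 / 8 := by rw [pow_one]; gcongr
  have hprod : ((k * q + 1 : ℕ) : ℝ) * δ ≤ 1 / 4 := by
    have h1 : ((k * q + 1 : ℕ) : ℝ) ≤ 2 * (N : ℝ) ^ (d + 1) := by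
      push_cast
      have : (k : ℝ) * q ≤ N * (N : ℝ) ^ d := by gcongr
      have h2 : (1 : ℝ) ≤ (N : ℝ) ^ (d + 1) := one_le_pow₀ (by linarith)
      rw [pow_succ'] at *
      linarith
    calc ((k * q + 1 : ℕ) : ℝ) * δ ≤ 2 * (N : ℝ) ^ (d + 1) * (2 / (N : ℝ) ^ (d + 3)) := by gcongr
      _ = 4 / (N : ℝ) ^ 2 := by field_simp; ring
      _ ≤ 4 / 8 ^ 2 := by gcongr
      _ ≤ 1 / 4 := by norm_num
  refine le_iInf₂ fun H hH => half_le_worstCaseRounds (n := N ^ 2) (R := R) hk hn hR1 H hH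
    (δ := ENNReal.ofReal δ) (β := ENNReal.ofReal β) ?_ ?_ ?_ ?_
  · intro t ht f₀ B
    exact natCast_card_le_ofReal_mul hδ0 (card_mismatch_le hR1 ht hn hN1 rfl f₀ B)
  · intro t ht f₀ B
    refine natCast_card_le_ofReal_mul hδ0 ((card_filter_isBase_le hR1 ht hn hN rfl f₀ B).trans ?_)
    gcongr
    exact le_add_of_nonneg_right (by positivity)
  · refine natCast_card_le_ofReal_mul hβ0 (card_filter_not_isFull_le hR1 hn (N := N) ?_)
    calc N * (k * N ^ 2 * R ^ k) ≤ N * (N * N ^ 2 * N) := by gcongr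
      _ = N ^ 5 := by ring
      _ ≤ N ^ 8 := Nat.pow_le_pow_right hN1 (by norm_num)
      _ ≤ m := hm
  · rw [← ENNReal.ofReal_natCast, ← ENNReal.ofReal_mul (Nat.cast_nonneg _),
      ← ENNReal.ofReal_add (by positivity) hβ0]
    refine (ENNReal.ofReal_le_ofReal (q := 1 / 2) (by linarith)).trans (le_of_eq ?_)
    rw [ENNReal.ofReal_div_of_pos (by norm_num)]
    simp

/-- The integer eighth root, taken as three nested square roots. -/
theorem exists_pow_eight_le_lt (m : ℕ) : ∃ N : ℕ, N ^ 8 ≤ m ∧ m < (N + 1) ^ 8 := by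
  have h1 := Nat.sqrt_le' m
  have h2 := Nat.lt_succ_sqrt' m
  have h3 := Nat.sqrt_le' m.sqrt
  have h4 := Nat.lt_succ_sqrt' m.sqrt
  have h5 := Nat.sqrt_le' m.sqrt.sqrt
  have h6 := Nat.lt_succ_sqrt' m.sqrt.sqrt
  refine ⟨m.sqrt.sqrt.sqrt, ?_, ?_⟩
  · calc m.sqrt.sqrt.sqrt ^ 8 = ((m.sqrt.sqrt.sqrt ^ 2) ^ 2) ^ 2 := by ring
      _ ≤ (m.sqrt.sqrt ^ 2) ^ 2 := by gcongr
      _ ≤ m.sqrt ^ 2 := by gcongr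
      _ ≤ m := h1
  · calc m < (m.sqrt + 1) ^ 2 := h2
      _ ≤ ((m.sqrt.sqrt + 1) ^ 2) ^ 2 := by gcongr; exact h4
      _ ≤ (((m.sqrt.sqrt.sqrt + 1) ^ 2) ^ 2) ^ 2 := by gcongr; exact h6
      _ = (m.sqrt.sqrt.sqrt + 1) ^ 8 := by ring

theorem eventually_exp_neg_le (a : ℕ) :
    ∀ᶠ N : ℕ in Filter.atTop, Real.exp (-N) ≤ 1 / (N : ℝ) ^ a := by
  have h := (Real.tendsto_pow_mul_exp_neg_atTop_nhds_zero a).comp tendsto_natCast_atTop_atTop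
  filter_upwards [h.eventually (ge_mem_nhds (zero_lt_one' ℝ)), Filter.eventually_ge_atTop 1]
    with N hN hN1
  have : (0 : ℝ) < N := by exact_mod_cast hN1
  rw [le_div_iff₀ (by positivity), mul_comm]
  exact hN

end LowerBound

end GraphicBasis

open GraphicBasis in
theorem mainTheorem2 (c : ℝ) (hc : 0 < c) :
    ∃ K : ℝ, 0 < K ∧ ∃ m₀ : ℕ, ∀ m : ℕ, m₀ ≤ m → ∀ q : ℕ, (q : ℝ) ≤ (m : ℝ) ^ c →
      ENNReal.ofReal (K * Real.log (m : ℝ)) ≤ GraphicBasis.probRounds m q := by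
  -- Since `m < (N + 1) ^ 8 ≤ N ^ 16`, the bound `m ^ c` on `q` is at most `N ^ d`.
  obtain ⟨d, hd⟩ := exists_nat_ge (16 * c)
  obtain ⟨N₀, hN₀⟩ := Filter.eventually_atTop.1 (eventually_exp_neg_le (d + 4))
  have hRpos : (1 : ℝ) < (d + 6 : ℕ) := by exact_mod_cast (by omega : 1 < d + 6)
  have hlogR : 0 < Real.log (d + 6 : ℕ) := Real.log_pos hRpos
  -- With `R = d + 6`, one has `log m ≤ 16 * log N` and `log N ≤ (k + 1) * log R ≤ 2 * k * log R`;
  -- the bound `k / 2` supplies the last factor of `64 = 16 * 2 * 2`. The term `d + 8` ensures `N ≥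
  -- 8` and `k ≥ 1`.
  refine ⟨1 / (64 * Real.log (d + 6 : ℕ)), by positivity, (max N₀ (d + 8)) ^ 8,
    fun m hm q hq => ?_⟩
  obtain ⟨N, hNm, hmN⟩ := exists_pow_eight_le_lt m
  have hN : max N₀ (d + 8) ≤ N := by
    have := lt_of_pow_lt_pow_left₀ 8 (Nat.zero_le _) (hm.trans_lt hmN)
    omega
  have hN1 : N₀ ≤ N := (le_max_left _ _).trans hN
  have hN2 : d + 8 ≤ N := (le_max_right _ _).trans hN
  have hNr : (8 : ℝ) ≤ N := by exact_mod_cast (by omega : 8 ≤ N)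
  have hm16 : (m : ℝ) ≤ (N : ℝ) ^ 16 := by
    have h1 : m ≤ N ^ 16 := by
      calc m ≤ (N + 1) ^ 8 := hmN.le
        _ ≤ (N ^ 2) ^ 8 := by
          gcongr
          nlinarith
        _ = N ^ 16 := by ring
    exact_mod_cast h1
  have hm0 : (0 : ℝ) < m := by
    have : 0 < m := lt_of_lt_of_le (Nat.pow_pos (by omega)) hNm
    exact_mod_cast this
  set k := Nat.log (d + 6) N with hk
  have hk1 : 1 ≤ k := Nat.log_pos (by omega) (by omega)
  have hqN : q ≤ N ^ d := by
    have h1 : (q : ℝ) ≤ (N : ℝ) ^ d := by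
      calc (q : ℝ) ≤ (m : ℝ) ^ c := hq
        _ ≤ ((N : ℝ) ^ 16) ^ c := Real.rpow_le_rpow hm0.le hm16 hc.le
        _ = (N : ℝ) ^ (16 * c) := by
          rw [← Real.rpow_natCast, ← Real.rpow_mul (by linarith)]
          norm_num
        _ ≤ (N : ℝ) ^ (d : ℝ) := Real.rpow_le_rpow_of_exponent_le (by linarith) hd
        _ = (N : ℝ) ^ d := Real.rpow_natCast _ _
    exact_mod_cast h1
  refine le_trans ?_ (half_le_probRounds (by omega) (hN₀ N hN1) hk1 rfl
    (Nat.pow_log_le_self _ (by omega)) hqN hNm)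
  have hlogN : Real.log N ≤ 2 * k * Real.log (d + 6 : ℕ) := by
    have h1 : (N : ℝ) ≤ ((d + 6 : ℕ) : ℝ) ^ (k + 1) := by
      exact_mod_cast (Nat.lt_pow_succ_log_self (by omega : 1 < d + 6) N).le
    have h2 := Real.log_le_log (by linarith) h1
    rw [Real.log_pow] at h2
    refine h2.trans ?_
    gcongr
    have : (1 : ℝ) ≤ k := by exact_mod_cast hk1
    push_cast
    linarith
  have hlogm : Real.log m ≤ 16 * Real.log N := by
    have := Real.log_le_log hm0 hm16
    rw [Real.log_pow] at this
    exact_mod_cast this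
  have hfin : 1 / (64 * Real.log (d + 6 : ℕ)) * Real.log m ≤ (k : ℝ) / 2 := by
    rw [one_div_mul_eq_div, div_le_iff₀ (by positivity)]
    linarith
  refine (ENNReal.ofReal_le_ofReal hfin).trans (le_of_eq ?_)
  rw [ENNReal.ofReal_div_of_pos (by norm_num), ENNReal.ofReal_natCast]
  simp
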